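/- **Stable hopping of the 1-DOF vertical hopper.** Fix $\omega,g,\beta,k>0$ and $z_0\in\mathbb R$. A unit mass at height $z$ obeys, for $\varepsilon\ge 0$, $\ddot z=u-g-\varepsilon\beta\dot z$ in stance and $\ddot z=-g$ in flight. In phase-energy coordinates $x=(\psi,a)$, $a>0$, defined by $a\sin\psi=z_0-z$, $a\omega\cos\psi=-\dot z$, the stance feedback is $$u=g+\omega^2a\sin\psi-\varepsilon\omega k\cos\psi .$$ With $v(\psi,a)=\omega(a\beta-k)\cos\psi$, the closed-loop stance dynamics are $$\dot\psi=\omega+\frac{\varepsilon}{\omega a}\,v\sin\psi,\qquad \dot a=-\frac{\varepsilon}{\omega}\,v\cos\psi .$$ Liftoff occurs on the guard $\mathcal G_\varepsilon=\{(\psi,a): \tfrac{\pi}{2}<\psi<\tfrac{3\pi}{2},\ a>0,\ \gamma(\psi,a)=0\}$ with $\gamma(\psi,a)=\omega\tan\psi-\varepsilon(k/a-\beta)$. Ballistic flight then takes the liftoff state to the touchdown state $$R(\psi,a)=\Big(0,\sqrt{a^2\cos^2\psi-2ga\sin\psi/\omega^2}\Big).$$ A *hop* takes a touchdown value $a$ to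 $a'$ if the stance trajectory from $(0,a)$ first reaches $\mathcal G_\varepsilon$ at a state $x$ and $R(x)=(0,a')$. The return map is $a\mapsto a'$. *Averageability.* In the time $s=\omega t$ the stance field is $e_1+\varepsilon(F_1,F_2)$ with $F_1=\frac{v\sin\psi}{\omega^2a}$, $F_2=-\frac{v\cos\psi}{\omega^2}$. Put $X_1=(-\tfrac{3\pi}2,\tfrac{3\pi}2)$, $X_2=(0,\infty)$, $X=X_1\times X_2$, $x^*=(x_1^*,x_2^*)=(\pi,k/\beta)$ and $\bar f(a)=\frac1\pi\int_0^{\pi}F_2(\sigma,a)\,d\sigma$. Let $\bar R_\varepsilon$ be the flow-to-reset map, defined for $a$ near $x_2^*$: flow from $(\pi,a)$, forward or backward in time, to $\mathcal G_\varepsilon$, along the branch of the hitting time that is continuous in $a$ and vanishes at $a=x_2^*$; then apply $R$ and take the second component. The family is *averageable at $x^*$ with coefficients $S_0,S_1$* for $0\le\varepsilon<\varepsilon_0$ if: - $X_1$ is an open interval around $0$, $X_2$ is an open topological ball, $x^*\in X$, and $F_1,F_2$ are $C^2$ on $X$; - $\bar f(x_2^*)=0$; - $\mathcal G_\varepsilon$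 contains $x^*$ and is the zero set of a regular $C^1$ function on $X$, and every such function $\tilde\gamma$ has $\partial_\psi\tilde\gamma\ne0$ on $\mathcal G_\varepsilon$; - $R$ is $C^2$ at the points of $\mathcal G_\varepsilon$, maps $\mathcal G_\varepsilon$ into $X$ with first component $0$, and $R(x^*)=(0,x_2^*)$; - $D\bar R_\varepsilon(a)=S_0+\varepsilon S_1(a)+O(\varepsilon^2)$ uniformly for $a$ in a neighbourhood of $x_2^*$, where $S_0$ is constant and invertible, the eigenvalue $1$ of $S_0$ (if present) is semisimple, and $S_1(x_2^*)+x_1^*S_0D\bar f(x_2^*)$ is invertible. It has *orthogonal reset* if moreover $S_0$ is orthogonal and $W:=S_0^{\mathsf T}S_1(x_2^*)+x_1^*D\bar f(x_2^*)$ is invertible. **Claim.** The displayed stance dynamics are the stance equation of motion written in the coordinates $(\psi,a)$. There are $\varepsilon_0>0$ and $K$, depending only on the parameters, such that: 1. For $0\le\varepsilon<\varepsilon_0$, $R$ maps each point of $\mathcal G_\varepsilon$ to a state with $z=z_0$, $\dot z<0$ and the same flight energy $\tfrac12\dot z^2+gz$. 2. For $0\le\varepsilon<\varepsilon_0$, the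 hopper is averageable at $(\pi,k/\beta)$ with orthogonal reset, $S_0=1$ and $$W=-\frac{g\beta^2}{k\omega^3}-\frac{\beta\pi}{2\omega}<0 .$$ 3. For every $0<\varepsilon<\varepsilon_0$ there are a touchdown value $b$ and a liftoff state $\tilde x\in\mathcal G_\varepsilon$ such that the hop from $b$ lifts off at $\tilde x$ and returns to $b$, with $\|\tilde x-(\pi,k/\beta)\|\le K\varepsilon$ and $|b-k/\beta|\le K\varepsilon$. The return map is well defined (each point has exactly one successor) on a neighbourhood of $b$, and $b$ is an exponentially stable fixed point of it. -/

import Mathlib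

open Set

noncomputable section

/-- Data of an `ε`-family of single-mode hybrid systems with state `(x₁, x₂) ∈ ℝ × E`: the factors of
the state space `X₁ × X₂`, the two components of the `ε`-perturbation of the unit-speed phase flow,
the guard, the reset map (only its values on the guard matter) and the base point `x⋆`. -/
structure HybridFamily (E : Type*) where
  X₁ : Set ℝ
  X₂ : Set E
  F₁ : ℝ → ℝ × E → ℝ
  F₂ : ℝ → ℝ × E → E
  G : ℝ → Set (ℝ × E)
  R : ℝ → ℝ × E → ℝ × E
  xs : ℝ × E

namespace HybridFamily

/-- The state space `X = X₁ × X₂`. -/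
def X {E : Type*} (H : HybridFamily E) : Set (ℝ × E) := H.X₁ ×ˢ H.X₂

/-- The vector field `F = e₁ + ε (F₁, F₂)`. -/
def field {E : Type*} [NormedAddCommGroup E] [NormedSpace ℝ E] (H : HybridFamily E)
    (ε : ℝ) (x : ℝ × E) : ℝ × E :=
  ((1 : ℝ), (0 : E)) + ε • (H.F₁ ε x, H.F₂ ε x)

/-- The averaged vector field `f̄(x₂) = (1 / x₁⋆) ∫₀^{x₁⋆} F₂(σ, x₂)|_{ε = 0} dσ`. -/
def averagedField {E : Type*} [NormedAddCommGroup E] [NormedSpace ℝ E] (H : HybridFamily E)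
    (y : E) : E :=
  (1 / H.xs.1) • ∫ σ in (0 : ℝ)..H.xs.1, H.F₂ 0 (σ, y)

/-- `γ` is a `C¹` function on `X`, regular along its zero set, whose zero set is `G ε`. -/
def IsGuardFunction {E : Type*} [NormedAddCommGroup E] [NormedSpace ℝ E] (H : HybridFamily E)
    (ε : ℝ) (γ : ℝ × E → ℝ) : Prop :=
  ContDiffOn ℝ 1 γ H.X ∧ H.G ε = {x ∈ H.X | γ x = 0} ∧ ∀ x ∈ H.G ε, fderiv ℝ γ x ≠ 0

/-- `Rbar` is, on the neighbourhood `V` of `x₂⋆`, the flow-to-reset map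
`y ↦ π₂ (R (Φ(τ(x₁⋆, y), (x₁⋆, y))))`. Here `τ` is the branch of the (possibly negative) time to
the guard that is continuous and vanishes at `x⋆`, and `c` is the trajectory from `(x₁⋆, y)`. -/
def IsFlowToReset {E : Type*} [NormedAddCommGroup E] [NormedSpace ℝ E] (H : HybridFamily E)
    (ε : ℝ) (V : Set E) (Rbar : E → E) : Prop :=
  ∃ τ : E → ℝ, ContinuousOn τ V ∧ τ H.xs.2 = 0 ∧
    ∀ y ∈ V, ∃ c : ℝ → ℝ × E, c 0 = (H.xs.1, y) ∧
      (∀ t ∈ uIcc 0 (τ y), c t ∈ H.X ∧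
        HasDerivWithinAt c (H.field ε (c t)) (uIcc 0 (τ y)) t) ∧
      c (τ y) ∈ H.G ε ∧ Rbar y = (H.R ε (c (τ y))).2

/-- The family is averageable at `x⋆` for `0 ≤ ε < ε₀`, with `S₀` and `S₁` the first two coefficients
of the `ε`-expansion of the derivative of the flow-to-reset map. -/
structure IsAverageable {E : Type*} [NormedAddCommGroup E] [NormedSpace ℝ E]
    (H : HybridFamily E) (ε₀ : ℝ) (S₀ : E →L[ℝ] E) (S₁ : E → E →L[ℝ] E) : Prop where
  phase_interval : ∃ l r : ℝ, l < 0 ∧ 0 < r ∧ H.X₁ = Ioo l r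
  slow_isOpen : IsOpen H.X₂
  slow_ball : Nonempty (H.X₂ ≃ₜ Metric.ball (0 : E) 1)
  base_mem : H.xs ∈ H.X
  base_pos : 0 < H.xs.1
  contDiffOn_F₁ : ContDiffOn ℝ 2 (fun q : ℝ × (ℝ × E) => H.F₁ q.1 q.2) (Ico 0 ε₀ ×ˢ H.X)
  contDiffOn_F₂ : ContDiffOn ℝ 2 (fun q : ℝ × (ℝ × E) => H.F₂ q.1 q.2) (Ico 0 ε₀ ×ˢ H.X)
  averaged_equilibrium : H.averagedField H.xs.2 = 0
  base_mem_guard : ∀ ε ∈ Ico 0 ε₀, H.xs ∈ H.G ε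
  guard_exists : ∀ ε ∈ Ico 0 ε₀, ∃ γ, H.IsGuardFunction ε γ
  guard_transverse : ∀ ε ∈ Ico 0 ε₀, ∀ γ, H.IsGuardFunction ε γ →
    ∀ x ∈ H.G ε, fderiv ℝ γ x ((1 : ℝ), (0 : E)) ≠ 0
  reset_contDiff : ∀ ε ∈ Ico 0 ε₀, ∀ x ∈ H.G ε,
    ContDiffWithinAt ℝ 2 (fun q : ℝ × (ℝ × E) => H.R q.1 q.2) (Ico 0 ε₀ ×ˢ univ) (ε, x)
  reset_mapsTo : ∀ ε ∈ Ico 0 ε₀, MapsTo (H.R ε) (H.G ε) H.X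
  reset_phase : ∀ ε ∈ Ico 0 ε₀, ∀ x ∈ H.G ε, (H.R ε x).1 = 0
  reset_base : ∀ ε ∈ Ico 0 ε₀, (H.R ε H.xs).2 = H.xs.2
  reset_expansion : ∃ r > 0, ∃ C : ℝ, ∃ Rbar : ℝ → E → E, ∀ ε ∈ Ico 0 ε₀,
    H.IsFlowToReset ε (Metric.ball H.xs.2 r) (Rbar ε) ∧
    ∀ y ∈ Metric.ball H.xs.2 r, DifferentiableAt ℝ (Rbar ε) y ∧
      ‖fderiv ℝ (Rbar ε) y - (S₀ + ε • S₁ y)‖ ≤ C * ε ^ 2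
  S₀_invertible : IsUnit S₀
  S₀_unity_semisimple : ∀ v : E, (S₀ - 1) ((S₀ - 1) v) = 0 → (S₀ - 1) v = 0
  hyperbolic : IsUnit (S₁ H.xs.2 + H.xs.1 • (S₀ * fderiv ℝ H.averagedField H.xs.2))

/-- `W = S₀ᵀ S₁(x₂⋆) + x₁⋆ Df̄(x₂⋆)`; for orthogonal `S₀` this is the operator with
`(S₀ + ε S₁)(I + ε x₁⋆ Df̄) = S₀ (I + ε W) + O(ε²)`. -/
def W {E : Type*} [NormedAddCommGroup E] [InnerProductSpace ℝ E] [CompleteSpace E]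
    (H : HybridFamily E) (S₀ : E →L[ℝ] E) (S₁ : E → E →L[ℝ] E) : E →L[ℝ] E :=
  ContinuousLinearMap.adjoint S₀ * S₁ H.xs.2 + H.xs.1 • fderiv ℝ H.averagedField H.xs.2

/-- Orthogonal reset: `S₀` is orthogonal and `W` is invertible. -/
def HasOrthogonalReset {E : Type*} [NormedAddCommGroup E] [InnerProductSpace ℝ E]
    [CompleteSpace E] (H : HybridFamily E) (S₀ : E →L[ℝ] E) (S₁ : E → E →L[ℝ] E) : Prop :=
  ContinuousLinearMap.adjoint S₀ * S₀ = 1 ∧ S₀ * ContinuousLinearMap.adjoint S₀ = 1 ∧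
    IsUnit (H.W S₀ S₁)

end HybridFamily

/-- Parameters of the vertical hopper of unit mass: virtual spring frequency `ω`, gravity `g`,
drag coefficient `β` (the drag is `ε β`), energizing gain `k`, nominal leg length `z₀`. -/
structure VerticalHopper where
  ω : ℝ
  g : ℝ
  β : ℝ
  k : ℝ
  z₀ : ℝ
  ω_pos : 0 < ω
  g_pos : 0 < g
  β_pos : 0 < β
  k_pos : 0 < k

namespace VerticalHopper

/-- The height `z` in phase-energy coordinates `x = (ψ, a)`: `a sin ψ = z₀ - z`. -/
def height (p : VerticalHopper) (x : ℝ × ℝ) : ℝ := p.z₀ - x.2 * Real.sin x.1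

/-- The velocity `ż` in phase-energy coordinates: `a ω cos ψ = - ż`. -/
def velocity (p : VerticalHopper) (x : ℝ × ℝ) : ℝ := -(x.2 * p.ω * Real.cos x.1)

/-- Mechanical energy in flight, `ż² / 2 + g z`. -/
def flightEnergy (p : VerticalHopper) (x : ℝ × ℝ) : ℝ :=
  p.velocity x ^ 2 / 2 + p.g * p.height x

/-- The stance feedback `u = g + ω² a sin ψ - ε ω k cos ψ`. -/
def control (p : VerticalHopper) (ε : ℝ) (x : ℝ × ℝ) : ℝ :=
  p.g + p.ω ^ 2 * x.2 * Real.sin x.1 - ε * p.ω * p.k * Real.cos x.1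

/-- The stance acceleration `u - g - ε β ż`. -/
def stanceAcceleration (p : VerticalHopper) (ε : ℝ) (x : ℝ × ℝ) : ℝ :=
  p.control ε x - p.g - ε * p.β * p.velocity x

/-- `v(ψ, a) = ω (a β - k) cos ψ`. -/
def v (p : VerticalHopper) (x : ℝ × ℝ) : ℝ := p.ω * (x.2 * p.β - p.k) * Real.cos x.1

/-- The `ε`-term of the closed-loop stance dynamics in phase-energy coordinates. -/
def perturbation (p : VerticalHopper) (x : ℝ × ℝ) : ℝ × ℝ :=
  (p.v x * Real.sin x.1 / (p.ω * x.2), -(p.v x * Real.cos x.1) / p.ω)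

/-- The closed-loop stance vector field in phase-energy coordinates (in physical time). -/
def stanceField (p : VerticalHopper) (ε : ℝ) (x : ℝ × ℝ) : ℝ × ℝ :=
  (p.ω, 0) + ε • p.perturbation x

/-- The liftoff function `γ = ω tan ψ - ε (k / a - β)`. -/
def γ (p : VerticalHopper) (ε : ℝ) (x : ℝ × ℝ) : ℝ :=
  p.ω * Real.tan x.1 - ε * (p.k / x.2 - p.β)

/-- The liftoff guard: the branch, through the base point `(π, k / β)`, of the zero set of `γ`.
(The poles of `tan` separate it from the branch through touchdown phase `0`.) -/
def guard (p : VerticalHopper) (ε : ℝ) : Set (ℝ × ℝ) :=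
  {x | x.1 ∈ Ioo (Real.pi / 2) (3 * Real.pi / 2) ∧ 0 < x.2 ∧ p.γ ε x = 0}

/-- The reset map: ballistic flight from liftoff to touchdown (phase `0`). -/
def reset (p : VerticalHopper) (x : ℝ × ℝ) : ℝ × ℝ :=
  (0, Real.sqrt (x.2 ^ 2 * Real.cos x.1 ^ 2 - 2 * p.g * x.2 * Real.sin x.1 / p.ω ^ 2))

/-- The hopper as a hybrid family, in the dimensionless time `ω t`, in which the unperturbed phase
has unit speed. -/
def system (p : VerticalHopper) : HybridFamily ℝ where
  X₁ := Ioo (-(3 * Real.pi / 2)) (3 * Real.pi / 2)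
  X₂ := Ioi 0
  F₁ := fun _ x => (p.perturbation x).1 / p.ω
  F₂ := fun _ x => (p.perturbation x).2 / p.ω
  G := p.guard
  R := fun _ x => p.reset x
  xs := (Real.pi, p.k / p.β)

/-- One hop: from touchdown `(0, a)` the stance dynamics reach the liftoff guard for the first time
at the state `x`, and the flight phase ends in the touchdown state `(0, a')`. -/
def IsHop (p : VerticalHopper) (ε a : ℝ) (x : ℝ × ℝ) (a' : ℝ) : Prop :=
  ∃ T > 0, ∃ c : ℝ → ℝ × ℝ, c 0 = (0, a) ∧
    (∀ t ∈ Icc 0 T, c t ∈ p.system.X ∧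
      HasDerivWithinAt c (p.stanceField ε (c t)) (Icc 0 T) t) ∧
    (∀ t ∈ Ico 0 T, c t ∉ p.guard ε) ∧
    c T = x ∧ x ∈ p.guard ε ∧ p.reset x = (0, a')

/-- On `S`, the return map `a ↦ a'` of the hopper is well defined (every `a ∈ S` has exactly one
successor) and equals `P`. -/
def IsReturnMapOn (p : VerticalHopper) (ε : ℝ) (P : ℝ → ℝ) (S : Set ℝ) : Prop :=
  ∀ a ∈ S, ∀ a' : ℝ, (∃ x, p.IsHop ε a x a') ↔ a' = P a

end VerticalHopper

/-- `b` is an exponentially stable fixed point of the map `P` with domain of definition `S`. -/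
def IsExpStableFixedPoint (P : ℝ → ℝ) (S : Set ℝ) (b : ℝ) : Prop :=
  b ∈ S ∧ P b = b ∧ ∃ δ > 0, ∃ M q : ℝ, 0 ≤ q ∧ q < 1 ∧ ∀ a : ℝ, |a - b| < δ →
    ∀ n : ℕ, P^[n] a ∈ S ∧ |P^[n] a - b| ≤ M * q ^ n * |a - b|

end

/-! Everything becomes explicit in the slow variable `j = (k/a - β)/ω`. In the time `ωt` one has `ψ'
= 1 - ε j cos ψ sin ψ` and `a' = ε j a cos² ψ`, so with the phase as independent variable the stance
dynamics are the scalar equation `dj/dψ = -ε j (j + ν) cos² ψ / (1 - ε j cos ψ sin ψ)`, `ν = β/ω`,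
and the guard is the graph `ψ = π + arctan (ε j)`. The solution `j = 0` is invariant, lifts off
exactly at `(π, k/β)`, and is fixed by the reset. The periodic hop is therefore known exactly for
every `ε`, and only its stability needs an argument.

Stability: the difference of two slow solutions is multiplied by an exponential
(`IsSlowSolution.sub_eq`). Compared with `j = 0`, stance multiplies `j` by some `θ ∈ [0, 1]`, which
does not move the amplitude away from `k/β` (`abs_amp_mul_slow_sub_le`). The reset, restricted to
the guard, has derivative `1 - ε g β² / (k ω³)` at `k/β` (`exists_reset_contraction`). A
nonexpansive map followed by a strict local contraction is a contraction towards `k/β`.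

Averageability: the liftoff phase is `O(ε)` from `π` and `j` moves at rate `O(ε)`, so flowing from
phase `π` to the guard changes `j` by `O(ε²)` in `C¹` (`hasDerivAt_liftoff`). To first order the
flow-to-reset map is thus the reset alone, expanded in `exists_resetAmpDeriv_bound`. Its zeroth
order is `amp ∘ slow = id`, hence `S₀ = 1`; the gravity term gives `S₁`, and the mean `1/2` of
`cos²` gives the other term of `W`. -/

/-! ### The slow equation: elementary bounds -/

/-- The rate factor `1 - ε j cos ψ sin ψ` of the phase along the slow variable `j`. -/
noncomputable def slowDenom (ε ψ j : ℝ) : ℝ := 1 - ε * j * (Real.cos ψ * Real.sin ψ)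

/-- The decay rate (divided by `ε`) of the slow variable with respect to the phase. -/
noncomputable def slowRate (ν ε ψ j : ℝ) : ℝ :=
  j * (j + ν) * Real.cos ψ ^ 2 / slowDenom ε ψ j

/-- The difference quotient of `slowRate` in the slow variable. -/
noncomputable def slowQuot (ν ε ψ i j : ℝ) : ℝ :=
  Real.cos ψ ^ 2 * (i + j + ν - ε * (Real.cos ψ * Real.sin ψ) * i * j) /
    (slowDenom ε ψ i * slowDenom ε ψ j)

/-- Solutions on `[0, 2π]` of the slow equation `dj/dψ = -ε slowRate`, extended to continuous
functions with values in `[-ν/2, ν/2]`. -/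
structure IsSlowSolution (ν ε : ℝ) (j : ℝ → ℝ) : Prop where
  continuous : Continuous j
  abs_le : ∀ s, |j s| ≤ ν / 2
  deriv : ∀ s ∈ Icc 0 (2 * Real.pi),
    HasDerivWithinAt j (-(ε * slowRate ν ε s (j s))) (Icc 0 (2 * Real.pi)) s

theorem abs_cos_mul_sin_le_one (ψ : ℝ) : |Real.cos ψ * Real.sin ψ| ≤ 1 := by
  rw [abs_mul]
  exact mul_le_one₀ (Real.abs_cos_le_one ψ) (abs_nonneg _) (Real.abs_sin_le_one ψ)

theorem abs_arctan_sub_arctan_le (x y : ℝ) : |Real.arctan x - Real.arctan y| ≤ |x - y| := by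
  have := Convex.norm_image_sub_le_of_norm_hasDerivWithin_le (f := Real.arctan) (s := univ)
    (f' := fun x => 1 / (1 + x ^ 2)) (C := 1) (x := y) (y := x)
    (fun x _ => (Real.hasDerivAt_arctan x).hasDerivWithinAt)
    (fun x _ => by
      rw [Real.norm_eq_abs, abs_of_nonneg (by positivity)]
      exact div_le_one_of_le₀ (by nlinarith [sq_nonneg x]) (by positivity))
    convex_univ (mem_univ _) (mem_univ _)
  simpa using this

section
variable {ν ε : ℝ}

theorem slowDenom_bounds (hε : 0 ≤ ε) (hs : ε * ν ≤ 1 / 100) (ψ : ℝ) {j : ℝ}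
    (hj : |j| ≤ ν / 2) : 1 / 2 ≤ slowDenom ε ψ j ∧ slowDenom ε ψ j ≤ 3 / 2 := by
  have h : |ε * j * (Real.cos ψ * Real.sin ψ)| ≤ 1 / 2 := by
    rw [abs_mul, abs_mul, abs_of_nonneg hε]
    have h1 : ε * |j| ≤ ε * (ν / 2) := by gcongr
    have h2 := abs_cos_mul_sin_le_one ψ
    have h3 : ε * |j| * |Real.cos ψ * Real.sin ψ| ≤ ε * |j| * 1 := by gcongr
    linarith
  have := abs_le.1 h
  unfold slowDenom
  constructor <;> linarith [this.1, this.2]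

theorem abs_slowRate_le (hν : 0 < ν) (hε : 0 ≤ ε) (hs : ε * ν ≤ 1 / 100) (ψ : ℝ) {j : ℝ}
    (hj : |j| ≤ ν / 2) : |slowRate ν ε ψ j| ≤ 3 / 2 * ν ^ 2 := by
  have hd := (slowDenom_bounds hε hs ψ hj).1
  unfold slowRate
  rw [abs_div, abs_of_nonneg (by linarith : 0 ≤ slowDenom ε ψ j), div_le_iff₀ (by linarith),
    abs_mul, abs_mul, abs_of_nonneg (sq_nonneg (Real.cos ψ))]
  have h1 : |j + ν| ≤ 3 / 2 * ν := by
    have := abs_le.1 hj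
    rw [abs_le]; constructor <;> linarith
  have h2 : |j| * |j + ν| * Real.cos ψ ^ 2 ≤ ν / 2 * (3 / 2 * ν) * 1 := by
    gcongr
    exact Real.cos_sq_le_one ψ
  nlinarith

theorem abs_slowQuot_le (hν : 0 < ν) (hε : 0 ≤ ε) (hs : ε * ν ≤ 1 / 100) (ψ : ℝ) {i j : ℝ}
    (hi : |i| ≤ ν / 2) (hj : |j| ≤ ν / 2) : |slowQuot ν ε ψ i j| ≤ 9 * ν := by
  have hdi := (slowDenom_bounds hε hs ψ hi).1
  have hdj := (slowDenom_bounds hε hs ψ hj).1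
  have hd : 1 / 4 ≤ slowDenom ε ψ i * slowDenom ε ψ j := by nlinarith
  unfold slowQuot
  rw [abs_div, abs_of_nonneg (by linarith : 0 ≤ slowDenom ε ψ i * slowDenom ε ψ j),
    div_le_iff₀ (by linarith), abs_mul, abs_of_nonneg (sq_nonneg (Real.cos ψ))]
  have h0 : |ε * (Real.cos ψ * Real.sin ψ) * i * j| ≤ ν / 4 := by
    rw [abs_mul, abs_mul, abs_mul, abs_of_nonneg hε]
    have : ε * |Real.cos ψ * Real.sin ψ| * |i| * |j| ≤ ε * 1 * (ν / 2) * (ν / 2) := by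
      gcongr
      exact abs_cos_mul_sin_le_one ψ
    nlinarith
  have h1 : |i + j + ν - ε * (Real.cos ψ * Real.sin ψ) * i * j| ≤ 9 / 4 * ν := by
    have h2 := abs_le.1 h0
    have h3 := abs_le.1 hi
    have h4 := abs_le.1 hj
    rw [abs_le]; constructor <;> linarith [h2.1, h2.2, h3.1, h3.2, h4.1, h4.2]
  have h2 : Real.cos ψ ^ 2 * |i + j + ν - ε * (Real.cos ψ * Real.sin ψ) * i * j|
      ≤ 1 * (9 / 4 * ν) := by
    gcongr
    exact Real.cos_sq_le_one ψ
  nlinarith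

theorem slowRate_sub (hε : 0 ≤ ε) (hs : ε * ν ≤ 1 / 100) (ψ : ℝ) {i j : ℝ}
    (hi : |i| ≤ ν / 2) (hj : |j| ≤ ν / 2) :
    slowRate ν ε ψ i - slowRate ν ε ψ j = slowQuot ν ε ψ i j * (i - j) := by
  have hdi : slowDenom ε ψ i ≠ 0 := by linarith [(slowDenom_bounds hε hs ψ hi).1]
  have hdj : slowDenom ε ψ j ≠ 0 := by linarith [(slowDenom_bounds hε hs ψ hj).1]
  unfold slowRate slowQuot
  field_simp
  unfold slowDenom
  ring

theorem continuous_slowDenom_comp {X : Type*} [TopologicalSpace X] {u i : X → ℝ}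
    (hu : Continuous u) (hi : Continuous i) : Continuous fun x => slowDenom ε (u x) (i x) := by
  unfold slowDenom
  fun_prop

theorem continuous_slowRate_comp {X : Type*} [TopologicalSpace X] {u i : X → ℝ}
    (hε : 0 ≤ ε) (hs : ε * ν ≤ 1 / 100) (hu : Continuous u) (hi : Continuous i)
    (hi' : ∀ x, |i x| ≤ ν / 2) : Continuous fun x => slowRate ν ε (u x) (i x) := by
  unfold slowRate
  refine Continuous.div (by fun_prop) (continuous_slowDenom_comp hu hi) fun x => ?_
  linarith [(slowDenom_bounds hε hs (u x) (hi' x)).1]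

theorem continuous_slowQuot_comp {X : Type*} [TopologicalSpace X] {u i j : X → ℝ}
    (hε : 0 ≤ ε) (hs : ε * ν ≤ 1 / 100) (hu : Continuous u) (hi : Continuous i)
    (hj : Continuous j) (hi' : ∀ x, |i x| ≤ ν / 2) (hj' : ∀ x, |j x| ≤ ν / 2) :
    Continuous fun x => slowQuot ν ε (u x) (i x) (j x) := by
  unfold slowQuot
  refine Continuous.div (by fun_prop)
    ((continuous_slowDenom_comp hu hi).mul (continuous_slowDenom_comp hu hj)) fun x => ?_
  have h1 := (slowDenom_bounds hε hs (u x) (hi' x)).1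
  have h2 := (slowDenom_bounds hε hs (u x) (hj' x)).1
  nlinarith

theorem isSlowSolution_zero (hν : 0 < ν) : IsSlowSolution ν ε fun _ => 0 where
  continuous := continuous_const
  abs_le := fun _ => by simpa using by linarith
  deriv := fun s _ => by simpa [slowRate] using hasDerivWithinAt_const s _ (0 : ℝ)

/-! ### Flow of the slow equation -/

/-- Clamping to `[-r, r]`. -/
noncomputable def clamp (r x : ℝ) : ℝ := max (min r x) (-r)

theorem abs_clamp_le {r : ℝ} (hr : 0 ≤ r) (x : ℝ) : |clamp r x| ≤ r := by
  unfold clamp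
  rw [abs_le]
  exact ⟨le_max_right _ _, max_le (min_le_left _ _) (by linarith)⟩

theorem clamp_of_abs_le {r x : ℝ} (h : |x| ≤ r) : clamp r x = x := by
  unfold clamp
  rw [min_eq_right (abs_le.1 h).2, max_eq_left (abs_le.1 h).1]

theorem abs_clamp_sub_le (r x y : ℝ) : |clamp r x - clamp r y| ≤ |x - y| :=
  (abs_max_sub_max_le_abs _ _ _).trans <| by
    have := abs_min_sub_min_le_max r x r y
    simpa using this

theorem continuous_clamp (r : ℝ) : Continuous (clamp r) := by
  unfold clamp
  fun_prop

/-- The flow of the slow equation, from the phase `s₀`. -/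
theorem exists_slowFlow (hν : 0 < ν) (hε : 0 ≤ ε) (hs : ε * ν ≤ 1 / 100) {s₀ : ℝ}
    (hs₀ : s₀ ∈ Icc 0 (2 * Real.pi)) :
    ∃ J : ℝ → ℝ → ℝ, Continuous (Function.uncurry J) ∧ (∀ y, IsSlowSolution ν ε (J y)) ∧
      ∀ y, |y| ≤ ν / 4 → J y s₀ = y := by
  have hπ := Real.pi_pos
  have hπ' := Real.pi_lt_d2
  have hc : ∀ x, |clamp (ν / 2) x| ≤ ν / 2 := abs_clamp_le (by linarith)
  -- Clamping makes the right-hand side bounded and Lipschitz on all of `ℝ`; by `hbound` below, the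
  -- solutions stay where the clamp is the identity.
  set f : ℝ → ℝ → ℝ := fun s x => -(ε * slowRate ν ε s (clamp (ν / 2) x)) with hf
  set B : ℝ := ε * (3 / 2 * ν ^ 2) with hB
  have hB0 : 0 ≤ B := by positivity
  have hfB : ∀ s x, |f s x| ≤ B := fun s x => by
    simp only [hf, hB, abs_neg, abs_mul, abs_of_nonneg hε]
    gcongr
    exact abs_slowRate_le hν hε hs s (hc x)
  -- The drift over a full turn is at most `ν/4`, exactly the room between initial values in `[-ν/4,
  -- ν/4]` and the range `[-ν/2, ν/2]`.
  have hBs : B * (2 * Real.pi) ≤ ν / 4 := by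
    have : B * (2 * Real.pi) = (ε * ν) * (3 * Real.pi) * ν := by rw [hB]; ring
    rw [this]
    have : (ε * ν) * (3 * Real.pi) ≤ 1 / 100 * (3 * 3.15) := by gcongr
    nlinarith
  have hPL : IsPicardLindelof f (⟨s₀, hs₀⟩ : Icc 0 (2 * Real.pi)) (0 : ℝ)
      (ν / 2).toNNReal (ν / 4).toNNReal B.toNNReal (ε * (9 * ν)).toNNReal := by
    refine ⟨fun s _ => ?_, fun x _ => ?_, fun s _ x _ => ?_, ?_⟩
    · refine LipschitzWith.lipschitzOnWith (LipschitzWith.of_dist_le_mul fun x y => ?_)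
      rw [Real.dist_eq, Real.dist_eq, Real.coe_toNNReal _ (by positivity)]
      have : f s x - f s y = -(ε * (slowQuot ν ε s (clamp (ν / 2) x) (clamp (ν / 2) y) *
          (clamp (ν / 2) x - clamp (ν / 2) y))) := by
        rw [← slowRate_sub hε hs s (hc x) (hc y)]
        simp only [hf]; ring
      rw [this, abs_neg, abs_mul, abs_mul, abs_of_nonneg hε, mul_assoc]
      exact mul_le_mul_of_nonneg_left (mul_le_mul (abs_slowQuot_le hν hε hs s (hc x) (hc y))
        (abs_clamp_sub_le _ x y) (abs_nonneg _) (by positivity)) hε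
    · exact (continuous_const.mul (continuous_slowRate_comp hε hs continuous_id
        continuous_const fun _ => hc x)).neg.continuousOn
    · rw [Real.norm_eq_abs, Real.coe_toNNReal _ hB0]
      exact hfB s x
    · rw [Real.coe_toNNReal _ hB0, Real.coe_toNNReal _ (by positivity),
        Real.coe_toNNReal _ (by positivity)]
      have : max (2 * Real.pi - s₀) (s₀ - 0) ≤ 2 * Real.pi :=
        max_le (by linarith [hs₀.1]) (by linarith [hs₀.2])
      calc B * max (2 * Real.pi - s₀) (s₀ - 0) ≤ B * (2 * Real.pi) := by gcongr
        _ ≤ ν / 2 - ν / 4 := by linarith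
  obtain ⟨α, hα, hαc⟩ := hPL.exists_forall_mem_closedBall_eq_hasDerivWithinAt_continuousOn
  rw [Real.coe_toNNReal _ (by positivity : 0 ≤ ν / 4)] at hα hαc
  have hmem : ∀ y, clamp (ν / 4) y ∈ Metric.closedBall (0 : ℝ) (ν / 4) := fun y => by
    rw [mem_closedBall_zero_iff]; exact abs_clamp_le (by linarith) y
  have h2π : (0 : ℝ) ≤ 2 * Real.pi := by linarith
  have hbound : ∀ y, ∀ s ∈ Icc 0 (2 * Real.pi), |α (clamp (ν / 4) y, s)| ≤ ν / 2 := by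
    intro y s hs'
    have h := Convex.norm_image_sub_le_of_norm_hasDerivWithin_le
      (f := fun s => α (clamp (ν / 4) y, s)) (C := B) (x := s₀) (y := s)
      (fun t ht => (hα _ (hmem y)).2 t ht) (fun t _ => hfB t _) (convex_Icc _ _) hs₀ hs'
    rw [(hα _ (hmem y)).1, Real.norm_eq_abs, Real.norm_eq_abs] at h
    have h1 : B * |s - s₀| ≤ B * (2 * Real.pi) := by
      gcongr
      rw [abs_le]; constructor <;> linarith [hs₀.1, hs₀.2, hs'.1, hs'.2]
    have h2 := abs_clamp_le (by linarith : 0 ≤ ν / 4) y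
    have h3 := abs_sub_abs_le_abs_sub (α (clamp (ν / 4) y, s)) (clamp (ν / 4) y)
    linarith
  -- Clamping `y` and projecting `s` makes the flow total and jointly continuous, so no domain
  -- conditions are carried along later.
  refine ⟨fun y s => α (clamp (ν / 4) y, projIcc 0 (2 * Real.pi) h2π s), ?_, ?_, ?_⟩
  · refine hαc.comp_continuous (f := fun q : ℝ × ℝ =>
      (clamp (ν / 4) q.1, (projIcc 0 (2 * Real.pi) h2π q.2 : ℝ))) ?_ ?_
    · exact ((continuous_clamp _).comp continuous_fst).prodMk
        (continuous_subtype_val.comp (continuous_projIcc.comp continuous_snd))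
    · exact fun q => ⟨hmem q.1, (projIcc 0 (2 * Real.pi) h2π q.2).2⟩
  · intro y
    refine ⟨?_, ?_, ?_⟩
    · refine hαc.comp_continuous (f := fun s : ℝ =>
        (clamp (ν / 4) y, (projIcc 0 (2 * Real.pi) h2π s : ℝ))) ?_ ?_
      · exact continuous_const.prodMk (continuous_subtype_val.comp continuous_projIcc)
      · exact fun q => ⟨hmem y, (projIcc 0 (2 * Real.pi) h2π q).2⟩
    · exact fun s => hbound y _ (projIcc 0 (2 * Real.pi) h2π s).2
    · intro s hs'
      have h := (hα _ (hmem y)).2 s hs'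
      simp only [hf] at h
      rw [clamp_of_abs_le (hbound y s hs')] at h
      simp only [projIcc_of_mem h2π hs']
      refine h.congr_of_mem (fun t ht => ?_) hs'
      simp only [projIcc_of_mem h2π ht]
  · intro y hy
    simp only [projIcc_of_mem h2π hs₀]
    rw [clamp_of_abs_le hy]
    have := hmem y
    rw [clamp_of_abs_le hy] at this
    exact (hα y this).1

/-! ### Comparison of slow solutions and the liftoff phase -/

namespace IsSlowSolution

theorem abs_sub_le {j : ℝ → ℝ} (h : IsSlowSolution ν ε j) (hν : 0 < ν) (hε : 0 ≤ ε)
    (hs : ε * ν ≤ 1 / 100) {s t : ℝ} (hs' : s ∈ Icc 0 (2 * Real.pi))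
    (ht : t ∈ Icc 0 (2 * Real.pi)) : |j s - j t| ≤ ε * (3 / 2 * ν ^ 2) * |s - t| := by
  refine Convex.norm_image_sub_le_of_norm_hasDerivWithin_le (f := j) (x := t) (y := s)
    h.deriv (fun u _ => ?_) (convex_Icc _ _) ht hs'
  rw [Real.norm_eq_abs, abs_neg, abs_mul, abs_of_nonneg hε]
  gcongr
  exact abs_slowRate_le hν hε hs u (h.abs_le u)

theorem continuous_quot {i j : ℝ → ℝ} (hi : IsSlowSolution ν ε i) (hj : IsSlowSolution ν ε j)
    (hε : 0 ≤ ε) (hs : ε * ν ≤ 1 / 100) :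
    Continuous fun u => slowQuot ν ε u (i u) (j u) :=
  continuous_slowQuot_comp hε hs continuous_id hi.continuous hj.continuous hi.abs_le hj.abs_le

/-- The difference of two solutions, by variation of constants. -/
theorem sub_eq {i j : ℝ → ℝ} (hi : IsSlowSolution ν ε i) (hj : IsSlowSolution ν ε j)
    (hε : 0 ≤ ε) (hs : ε * ν ≤ 1 / 100) {s₀ s : ℝ}
    (hs₀ : s₀ ∈ Icc 0 (2 * Real.pi)) (hs' : s ∈ Icc 0 (2 * Real.pi)) :
    i s - j s = (i s₀ - j s₀) * Real.exp (-(ε * ∫ u in s₀..s, slowQuot ν ε u (i u) (j u))) := by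
  have hc := hi.continuous_quot hj hε hs
  set I : ℝ → ℝ := fun s => ∫ u in s₀..s, slowQuot ν ε u (i u) (j u) with hI
  have hId : ∀ s, HasDerivAt I (slowQuot ν ε s (i s) (j s)) s := fun s =>
    intervalIntegral.integral_hasDerivAt_right (hc.intervalIntegrable _ _)
      (hc.stronglyMeasurableAtFilter _ _) hc.continuousAt
  -- Integrating factor: `i - j` solves a linear equation with coefficient `-ε slowQuot`, so this
  -- product is constant.
  set f : ℝ → ℝ := fun s => (i s - j s) * Real.exp (ε * I s) with hf
  have hd : ∀ s ∈ Icc 0 (2 * Real.pi), HasDerivWithinAt f 0 (Icc 0 (2 * Real.pi)) s := by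
    intro s hs'
    have := ((hi.deriv s hs').sub (hj.deriv s hs')).mul
      (((hId s).const_mul ε).exp.hasDerivWithinAt (s := Icc 0 (2 * Real.pi)))
    refine this.congr_deriv ?_
    have h := slowRate_sub hε hs s (hi.abs_le s) (hj.abs_le s)
    simp only [Pi.sub_apply]
    linear_combination (-ε * Real.exp (ε * I s)) * h
  have hconst := Convex.norm_image_sub_le_of_norm_hasDerivWithin_le (f := f) (C := 0)
    (f' := fun _ => 0) (x := s₀) (y := s) hd (fun _ _ => by simp) (convex_Icc _ _) hs₀ hs'
  have h0 : f s = f s₀ := by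
    rw [zero_mul, norm_le_zero_iff, sub_eq_zero] at hconst; exact hconst
  have hI0 : I s₀ = 0 := by simp [hI]
  simp only [hf, hI0, mul_zero, Real.exp_zero, mul_one] at h0
  rw [← h0, mul_assoc, ← Real.exp_add]
  simp [hI]

/-- Intermediate value theorem on `[π/2, 3π/2]`: since `arctan` takes values in `(-π/2, π/2)`, the
difference of the two sides changes sign. -/
theorem exists_liftoff {j : ℝ → ℝ} (h : IsSlowSolution ν ε j) :
    ∃ ψ, ψ = Real.pi + Real.arctan (ε * j ψ) := by
  have hc : Continuous fun ψ => ψ - Real.pi - Real.arctan (ε * j ψ) := by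
    have := h.continuous
    have h2 := Real.continuous_arctan
    fun_prop
  have hπ := Real.pi_pos
  have hiv := intermediate_value_Icc (a := Real.pi / 2) (b := 3 * Real.pi / 2) (by linarith)
    hc.continuousOn
  obtain ⟨ψ, -, hψ⟩ := hiv (show (0 : ℝ) ∈ _ from
    ⟨by linarith [Real.neg_pi_div_two_lt_arctan (ε * j (Real.pi / 2))],
      by linarith [Real.arctan_lt_pi_div_two (ε * j (3 * Real.pi / 2))]⟩)
  exact ⟨ψ, by linarith⟩

end IsSlowSolution

theorem liftoff_mem_Ioo {ψ x : ℝ} (h : ψ = Real.pi + Real.arctan x) :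
    ψ ∈ Ioo (Real.pi / 2) (3 * Real.pi / 2) := by
  have h1 := Real.neg_pi_div_two_lt_arctan x
  have h2 := Real.arctan_lt_pi_div_two x
  constructor <;> linarith

theorem liftoff_mem_Icc {ψ x : ℝ} (h : ψ = Real.pi + Real.arctan x) :
    ψ ∈ Icc 0 (2 * Real.pi) := by
  have := liftoff_mem_Ioo h
  have hπ := Real.pi_pos
  constructor <;> linarith [this.1, this.2]

/-- The right-hand side of the liftoff equation has Lipschitz constant at most `(3/2) (ε ν)² < 1` on
`[0, 2π]`. -/
theorem IsSlowSolution.liftoff_unique {j : ℝ → ℝ} (h : IsSlowSolution ν ε j) (hν : 0 < ν)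
    (hε : 0 ≤ ε) (hs : ε * ν ≤ 1 / 100) {ψ φ : ℝ} (hψ : ψ = Real.pi + Real.arctan (ε * j ψ))
    (hφ : φ = Real.pi + Real.arctan (ε * j φ)) : ψ = φ := by
  have h1 := abs_arctan_sub_arctan_le (ε * j ψ) (ε * j φ)
  have h2 := h.abs_sub_le hν hε hs (liftoff_mem_Icc hψ) (liftoff_mem_Icc hφ)
  rw [← mul_sub, abs_mul, abs_of_nonneg hε] at h1
  have h3 : Real.arctan (ε * j ψ) - Real.arctan (ε * j φ) = ψ - φ := by linarith
  rw [h3] at h1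
  have h4 : ε * |j ψ - j φ| ≤ ε * (ε * (3 / 2 * ν ^ 2) * |ψ - φ|) := by gcongr
  have h5 : ε * (ε * (3 / 2 * ν ^ 2) * |ψ - φ|) = (ε * ν) ^ 2 * (3 / 2) * |ψ - φ| := by ring
  have h6 : (ε * ν) ^ 2 ≤ (1 / 100) ^ 2 := by gcongr
  have h7 : |ψ - φ| ≤ 0 := by nlinarith [abs_nonneg (ψ - φ)]
  have := abs_eq_zero.1 (le_antisymm h7 (abs_nonneg _))
  linarith

end

/-! ### Differentiating the slow variable at liftoff -/

theorem hasDerivAt_of_sub_eq_mul {g φ : ℝ → ℝ} {y₀ : ℝ}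
    (h : ∀ᶠ y in nhds y₀, g y - g y₀ = (y - y₀) * φ y) (hφ : ContinuousAt φ y₀) :
    HasDerivAt g (φ y₀) y₀ := by
  rw [hasDerivAt_iff_tendsto_slope]
  refine Filter.Tendsto.congr' ?_ (hφ.tendsto.mono_left nhdsWithin_le_nhds)
  filter_upwards [nhdsWithin_le_nhds h, self_mem_nhdsWithin] with y hy hne
  have : y - y₀ ≠ 0 := sub_ne_zero.2 hne
  rw [slope_def_field, hy]
  field_simp

/-- If `K ∘ g` vanishes to first order with rate `E y₀` and `K` has derivative `κ ≠ 0`, then the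
continuous function `g` has derivative `E y₀ / κ`. -/
theorem hasDerivAt_of_comp_eq_mul {g K E : ℝ → ℝ} {y₀ κ : ℝ} (hg : ContinuousAt g y₀)
    (hK : HasDerivAt K κ (g y₀)) (hκ : κ ≠ 0) (hE : ContinuousAt E y₀)
    (h : ∀ᶠ y in nhds y₀, K (g y) - K (g y₀) = (y - y₀) * E y) :
    HasDerivAt g (E y₀ / κ) y₀ := by
  have hd : dslope K (g y₀) (g y₀) = κ := by rw [dslope_same, hK.deriv]
  have hc : ContinuousAt (fun y => dslope K (g y₀) (g y)) y₀ :=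
    (continuousAt_dslope_same.2 hK.differentiableAt).comp (f := g) hg
  have hne : ∀ᶠ y in nhds y₀, dslope K (g y₀) (g y) ≠ 0 :=
    hc.eventually_ne (by simpa only [hd] using hκ)
  have := hasDerivAt_of_sub_eq_mul (g := g) (φ := fun y => E y / dslope K (g y₀) (g y))
    (y₀ := y₀) ?_ (hE.div hc (by simpa only [hd] using hκ))
  · simpa only [hd] using this
  · filter_upwards [h, hne] with y hy hne
    rw [← mul_div_assoc, ← hy, eq_div_iff hne, ← smul_eq_mul, sub_smul_dslope]

section
variable {ν ε : ℝ}

/-- The contraction estimate behind uniqueness, applied to two different solutions, bounds the gap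
of liftoff phases by the gap of the solutions at one fixed phase. -/
theorem continuous_liftoff (hν : 0 < ν) (hε : 0 ≤ ε) (hs : ε * ν ≤ 1 / 100) {J : ℝ → ℝ → ℝ}
    {Ψ : ℝ → ℝ} (hJ : Continuous (Function.uncurry J)) (hsol : ∀ y, IsSlowSolution ν ε (J y))
    (hΨ : ∀ y, Ψ y = Real.pi + Real.arctan (ε * J y (Ψ y))) : Continuous Ψ := by
  have key : ∀ y z, |Ψ y - Ψ z| ≤ 2 * ε * |J y (Ψ z) - J z (Ψ z)| := by
    intro y z
    have h1 := abs_arctan_sub_arctan_le (ε * J y (Ψ y)) (ε * J z (Ψ z))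
    have h3 : Real.arctan (ε * J y (Ψ y)) - Real.arctan (ε * J z (Ψ z)) = Ψ y - Ψ z := by
      linarith [hΨ y, hΨ z]
    rw [h3, ← mul_sub, abs_mul, abs_of_nonneg hε] at h1
    have h2 := (hsol y).abs_sub_le hν hε hs (liftoff_mem_Icc (hΨ y)) (liftoff_mem_Icc (hΨ z))
    have h4 := abs_sub_le (J y (Ψ y)) (J y (Ψ z)) (J z (Ψ z))
    have h5 : ε * |J y (Ψ y) - J z (Ψ z)| ≤ ε * (ε * (3 / 2 * ν ^ 2) * |Ψ y - Ψ z| +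
        |J y (Ψ z) - J z (Ψ z)|) := by gcongr; linarith
    have h6 : (ε * ν) ^ 2 ≤ (1 / 100) ^ 2 := by gcongr
    nlinarith [abs_nonneg (Ψ y - Ψ z)]
  rw [continuous_iff_continuousAt]
  intro z
  rw [ContinuousAt, tendsto_iff_norm_sub_tendsto_zero]
  have hc : Continuous fun y => 2 * ε * |J y (Ψ z) - J z (Ψ z)| := by
    have : Continuous fun y => J y (Ψ z) := hJ.comp (continuous_id.prodMk continuous_const)
    fun_prop
  have h0 := hc.tendsto z
  simp only [sub_self, abs_zero, mul_zero] at h0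
  exact squeeze_zero (fun _ => norm_nonneg _) (fun y => key y z) h0

/-- The slow variable at liftoff differs from its value at phase `π` by `O(ε²)`, in `C¹`. -/
theorem hasDerivAt_liftoff (hν : 0 < ν) (hε : 0 ≤ ε) (hs : ε * ν ≤ 1 / 100) {J : ℝ → ℝ → ℝ}
    {Ψ : ℝ → ℝ} (hJ : Continuous (Function.uncurry J)) (hsol : ∀ y, IsSlowSolution ν ε (J y))
    (hJπ : ∀ y, |y| ≤ ν / 4 → J y Real.pi = y)
    (hΨ : ∀ y, Ψ y = Real.pi + Real.arctan (ε * J y (Ψ y))) {y₀ : ℝ} (hy₀ : |y₀| < ν / 4) :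
    |J y₀ (Ψ y₀) - y₀| ≤ ν ^ 3 * ε ^ 2 ∧
      ∃ d, HasDerivAt (fun y => J y (Ψ y)) d y₀ ∧ |d - 1| ≤ 21 * ν ^ 2 * ε ^ 2 := by
  have hπ := Real.pi_pos
  have hπm : Real.pi ∈ Icc 0 (2 * Real.pi) := ⟨by linarith, by linarith⟩
  have hΨc := continuous_liftoff hν hε hs hJ hsol hΨ
  -- This `O(ε)` phase gap, multiplied by the `O(ε)` rate of `j`, is the source of every `ε²` below.
  have hΨπ : |Ψ y₀ - Real.pi| ≤ ε * ν / 2 := by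
    have h1 := abs_arctan_sub_arctan_le (ε * J y₀ (Ψ y₀)) 0
    rw [Real.arctan_zero, sub_zero, sub_zero, abs_mul, abs_of_nonneg hε] at h1
    have h2 : Ψ y₀ - Real.pi = Real.arctan (ε * J y₀ (Ψ y₀)) := by linarith [hΨ y₀]
    have h3 : ε * |J y₀ (Ψ y₀)| ≤ ε * (ν / 2) := by gcongr; exact (hsol y₀).abs_le _
    rw [h2]; linarith
  have hεν : 0 ≤ ε * ν := by positivity
  constructor
  · have h := (hsol y₀).abs_sub_le hν hε hs (liftoff_mem_Icc (hΨ y₀)) hπm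
    rw [hJπ y₀ hy₀.le] at h
    have h1 : ε * (3 / 2 * ν ^ 2) * |Ψ y₀ - Real.pi| ≤ ε * (3 / 2 * ν ^ 2) * (ε * ν / 2) := by
      gcongr
    have h2 : 0 ≤ ε ^ 2 * ν ^ 3 := by positivity
    nlinarith
  set E : ℝ → ℝ := fun y =>
    Real.exp (-(ε * ∫ u in Real.pi..Ψ y, slowQuot ν ε u (J y u) (J y₀ u))) with hE
  have hEc : Continuous E := by
    have hq : Continuous (Function.uncurry fun y u => slowQuot ν ε u (J y u) (J y₀ u)) :=
      continuous_slowQuot_comp hε hs continuous_snd hJ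
        ((hsol y₀).continuous.comp continuous_snd) (fun q => (hsol q.1).abs_le q.2)
        fun q => (hsol y₀).abs_le q.2
    have := intervalIntegral.continuous_parametric_intervalIntegral_of_continuous
      (a₀ := Real.pi) (μ := MeasureTheory.volume) hq hΨc
    simp only [hE]
    fun_prop
  set g : ℝ → ℝ := fun y => J y (Ψ y) with hg
  have hgc : Continuous g := hJ.comp (continuous_id.prodMk hΨc)
  set x₀ := g y₀ with hx₀
  -- `κ` is the derivative at `x₀` of the function `K` defined below.
  set κ : ℝ := 1 + ε ^ 2 * slowRate ν ε (Ψ y₀) x₀ / (1 + (ε * x₀) ^ 2) with hκ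
  have hκ1 : |κ - 1| ≤ 3 / 2 * (ε * ν) ^ 2 := by
    have h1 : κ - 1 = ε ^ 2 * slowRate ν ε (Ψ y₀) x₀ / (1 + (ε * x₀) ^ 2) := by rw [hκ]; ring
    have h2 : |slowRate ν ε (Ψ y₀) x₀| ≤ 3 / 2 * ν ^ 2 :=
      abs_slowRate_le hν hε hs _ ((hsol y₀).abs_le _)
    rw [h1, abs_div, abs_of_nonneg (by positivity : 0 ≤ 1 + (ε * x₀) ^ 2),
      div_le_iff₀ (by positivity), abs_mul, abs_of_nonneg (sq_nonneg ε)]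
    have h3 : ε ^ 2 * |slowRate ν ε (Ψ y₀) x₀| ≤ ε ^ 2 * (3 / 2 * ν ^ 2) := by gcongr
    have h4 : 0 ≤ 3 / 2 * (ε * ν) ^ 2 * (ε * x₀) ^ 2 := by positivity
    nlinarith
  have hsq : (ε * ν) ^ 2 ≤ (1 / 100) ^ 2 := by gcongr
  have hκ2 : 1 / 2 ≤ κ := by linarith [(abs_le.1 hκ1).1]
  -- At `x = g y` the phase `π + arctan (ε x)` is `Ψ y`, so `K (g y)` is the difference of two
  -- solutions at one phase, namely `(y - y₀) * E y`. This gives the derivative of `g` without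
  -- differentiating the flow in its initial value.
  set K : ℝ → ℝ := fun x => x - J y₀ (Real.pi + Real.arctan (ε * x)) with hK
  have hKd : HasDerivAt K κ x₀ := by
    have h1 : HasDerivAt (fun x => Real.pi + Real.arctan (ε * x))
        (1 / (1 + (ε * x₀) ^ 2) * ε) x₀ := by
      have := (((hasDerivAt_id x₀).const_mul ε).arctan).const_add Real.pi
      simpa using this
    have hm := liftoff_mem_Ioo (hΨ y₀)
    have h2 : HasDerivAt (J y₀) (-(ε * slowRate ν ε (Ψ y₀) x₀))
        (Real.pi + Real.arctan (ε * x₀)) := by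
      have : Real.pi + Real.arctan (ε * x₀) = Ψ y₀ := (hΨ y₀).symm
      rw [this]
      exact ((hsol y₀).deriv _ (liftoff_mem_Icc (hΨ y₀))).hasDerivAt
        (Icc_mem_nhds (by linarith [hm.1]) (by linarith [hm.2]))
    have h3 := (hasDerivAt_id x₀).sub (h2.comp x₀ h1)
    refine h3.congr_deriv ?_
    rw [hκ]
    field_simp
    ring
  have hKg : ∀ y, K (g y) = J y (Ψ y) - J y₀ (Ψ y) := fun y => by
    simp only [hK, hg]
    rw [← hΨ y]
  refine ⟨E y₀ / κ, hasDerivAt_of_comp_eq_mul hgc.continuousAt hKd (by linarith)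
    hEc.continuousAt ?_, ?_⟩
  · have hnhds : ∀ᶠ y in nhds y₀, |y| < ν / 4 :=
      continuous_abs.continuousAt.eventually_lt continuousAt_const hy₀
    filter_upwards [hnhds] with y hy
    rw [hKg, hKg, sub_self, sub_zero, (hsol y).sub_eq (hsol y₀) hε hs hπm
      (liftoff_mem_Icc (hΨ y)), hJπ y hy.le, hJπ y₀ hy₀.le]
  · have hI : ‖∫ u in Real.pi..Ψ y₀, slowQuot ν ε u (J y₀ u) (J y₀ u)‖ ≤
        9 * ν * |Ψ y₀ - Real.pi| :=
      intervalIntegral.norm_integral_le_of_norm_le_const fun u _ =>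
        abs_slowQuot_le hν hε hs u ((hsol y₀).abs_le u) ((hsol y₀).abs_le u)
    set I := ∫ u in Real.pi..Ψ y₀, slowQuot ν ε u (J y₀ u) (J y₀ u) with hIdef
    have h1 : |-(ε * I)| ≤ 9 / 2 * (ε * ν) ^ 2 := by
      rw [abs_neg, abs_mul, abs_of_nonneg hε]
      have : ε * |I| ≤ ε * (9 * ν * (ε * ν / 2)) := by
        gcongr
        exact hI.trans (by gcongr)
      nlinarith
    have h2 := Real.abs_exp_sub_one_le (x := -(ε * I)) (by linarith)
    have hE1 : |E y₀ - 1| ≤ 9 * (ε * ν) ^ 2 := by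
      have : E y₀ = Real.exp (-(ε * I)) := rfl
      rw [this]; linarith
    have h3 : E y₀ / κ - 1 = ((E y₀ - 1) - (κ - 1)) / κ := by
      have : κ ≠ 0 := by linarith
      field_simp
      ring
    rw [h3, abs_div, abs_of_nonneg (by linarith : 0 ≤ κ), div_le_iff₀ (by linarith)]
    have h4 := abs_sub (E y₀ - 1) (κ - 1)
    have h5 : 0 ≤ ν ^ 2 * ε ^ 2 := by positivity
    nlinarith

end

/-! ### Passing from phase to time -/

/-- Reparametrization by time: `σ` inverts `ψ ↦ ∫ g` from `ψ₀`. -/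
theorem exists_timeChange {g : ℝ → ℝ} (hg : Continuous g) {m : ℝ} (hm : 0 < m)
    (hgm : ∀ x, m ≤ g x) (ψ₀ : ℝ) :
    ∃ σ : ℝ → ℝ, StrictMono σ ∧ (∀ t, HasDerivAt σ (g (σ t))⁻¹ t) ∧
      ∀ ψ, σ (∫ u in ψ₀..ψ, g u) = ψ := by
  set s : ℝ → ℝ := fun ψ => ∫ u in ψ₀..ψ, g u with hs
  have hsd : ∀ ψ, HasDerivAt s (g ψ) ψ := fun ψ =>
    intervalIntegral.integral_hasDerivAt_right (hg.intervalIntegrable _ _)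
      (hg.stronglyMeasurableAtFilter _ _) hg.continuousAt
  have hsc : Continuous s := continuous_iff_continuousAt.2 fun ψ => (hsd ψ).continuousAt
  have hmono : StrictMono s := strictMono_of_hasDerivAt_pos hsd fun ψ => by linarith [hgm ψ]
  -- Linear growth makes the time function surjective, so its inverse is defined on all of `ℝ`.
  have hlow : ∀ x y, x ≤ y → m * (y - x) ≤ s y - s x := fun x y hxy =>
    (convex_univ (𝕜 := ℝ)).mul_sub_le_image_sub_of_le_deriv hsc.continuousOn
      (fun ψ _ => (hsd ψ).differentiableAt.differentiableWithinAt)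
      (fun ψ _ => by rw [(hsd ψ).deriv]; exact hgm ψ) x (mem_univ _) y (mem_univ _) hxy
  have htop : Filter.Tendsto s Filter.atTop Filter.atTop := by
    refine Filter.tendsto_atTop_mono' _ ?_ (Filter.tendsto_atTop_add_const_right _ (s 0)
      (Filter.tendsto_id.const_mul_atTop hm))
    filter_upwards [Filter.eventually_ge_atTop 0] with x hx
    have := hlow 0 x hx
    simp only [id]; linarith
  have hbot : Filter.Tendsto s Filter.atBot Filter.atBot := by
    refine Filter.tendsto_atBot_mono' _ ?_ (Filter.tendsto_atBot_add_const_right _ (s 0)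
      (Filter.tendsto_id.const_mul_atBot hm))
    filter_upwards [Filter.eventually_le_atBot 0] with x hx
    have := hlow x 0 hx
    simp only [id]; linarith
  set e := hmono.orderIsoOfSurjective s (hsc.surjective htop hbot) with he
  refine ⟨e.symm, e.symm.strictMono, fun t => ?_, fun ψ => e.symm_apply_apply ψ⟩
  refine HasDerivAt.of_local_left_inverse (f := s) e.symm.continuous.continuousAt
    (hsd _) (by linarith [hgm (e.symm t)]) ?_
  exact Filter.Eventually.of_forall fun y => e.apply_symm_apply y

/-! ### The hopper in the slow variable -/

namespace VerticalHopper

variable (p : VerticalHopper)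

/-- The slow variable `(k / a - β) / ω`; the guard is `ψ = π + arctan (ε j)`. -/
noncomputable def slow (a : ℝ) : ℝ := (p.k / a - p.β) / p.ω

/-- The amplitude with a given value of the slow variable. -/
noncomputable def amp (j : ℝ) : ℝ := p.k / (p.ω * j + p.β)

/-- The decay exponent of the slow variable. -/
noncomputable def rate : ℝ := p.β / p.ω

/-- The range of `ε`. -/
noncomputable def epsMax : ℝ :=
  min (1 / (100 * p.rate)) (p.k / (4 * (p.g / p.ω ^ 2) * p.rate * p.β))

theorem rate_pos : 0 < p.rate := div_pos p.β_pos p.ω_pos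

theorem epsMax_pos : 0 < p.epsMax := by
  have := p.rate_pos; have := p.g_pos; have := p.ω_pos; have := p.β_pos; have := p.k_pos
  unfold epsMax
  positivity

theorem mul_rate_le {ε : ℝ} (h : ε ≤ p.epsMax) : ε * p.rate ≤ 1 / 100 := by
  have hr := p.rate_pos
  have := h.trans (min_le_left _ _)
  rw [le_div_iff₀ (by positivity)] at this
  linarith

theorem mul_gravity_le {ε : ℝ} (h : ε ≤ p.epsMax) :
    4 * (p.g / p.ω ^ 2) * (ε * p.rate) ≤ p.k / p.β := by
  have hr := p.rate_pos; have := p.g_pos; have := p.ω_pos; have := p.β_pos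
  have := h.trans (min_le_right _ _)
  rw [le_div_iff₀ (by positivity)] at this
  rw [le_div_iff₀ p.β_pos]
  linarith

theorem denom_pos {j : ℝ} (hj : |j| ≤ p.rate / 2) : p.β / 2 ≤ p.ω * j + p.β := by
  have h := (abs_le.1 hj).1
  have hω := p.ω_pos
  have h1 : p.ω * p.rate = p.β := by unfold rate; field_simp
  nlinarith

theorem amp_pos {j : ℝ} (hj : |j| ≤ p.rate / 2) : 0 < p.amp j :=
  div_pos p.k_pos (by linarith [p.denom_pos hj, p.β_pos])

theorem amp_slow {a : ℝ} (ha : 0 < a) : p.amp (p.slow a) = a := by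
  have := p.ω_pos; have := p.k_pos
  have h : p.ω * ((p.k / a - p.β) / p.ω) + p.β = p.k / a := by field_simp; ring
  unfold amp slow
  rw [h]
  field_simp

theorem slow_amp (j : ℝ) : p.slow (p.amp j) = j := by
  have := p.ω_pos; have := p.k_pos
  unfold amp slow
  field_simp
  ring

theorem slow_base : p.slow (p.k / p.β) = 0 := by
  have := p.β_pos; have := p.k_pos
  unfold slow
  field_simp
  simp

theorem amp_zero : p.amp 0 = p.k / p.β := by simp [amp]

theorem hasDerivAt_amp {j : ℝ} (hj : p.ω * j + p.β ≠ 0) :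
    HasDerivAt p.amp (-(p.k * p.ω) / (p.ω * j + p.β) ^ 2) j := by
  have h : HasDerivAt (fun j => p.ω * j + p.β) p.ω j := by
    simpa using ((hasDerivAt_id j).const_mul p.ω).add_const p.β
  have := (hasDerivAt_const j p.k).div h hj
  exact this.congr_deriv (by ring)

theorem hasDerivAt_slow {a : ℝ} (ha : a ≠ 0) :
    HasDerivAt p.slow (-(p.k / (p.ω * a ^ 2))) a := by
  have h := (((hasDerivAt_const a p.k).div (hasDerivAt_id a) ha).sub_const p.β).div_const p.ω
  refine h.congr_deriv ?_
  have := p.ω_pos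
  simp only [id]
  field_simp
  ring

/-- The radius `1/5` is chosen so that `a > (4/5) k/β` gives `k/a - β < β/4`; the lower bound has
room to spare. -/
theorem abs_slow_lt {a : ℝ} (ha : |a - p.k / p.β| < p.k / p.β / 5) :
    0 < a ∧ |p.slow a| < p.rate / 4 := by
  have hβ := p.β_pos; have hk := p.k_pos; have hω := p.ω_pos
  obtain ⟨h1, h2⟩ := abs_lt.1 ha
  have hb : 0 < p.k / p.β := div_pos hk hβ
  have ha0 : 0 < a := by linarith
  have hkb : p.k = p.β * (p.k / p.β) := by field_simp
  refine ⟨ha0, ?_⟩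
  unfold slow rate
  rw [abs_div, abs_of_pos hω, div_div, mul_comm p.ω 4, ← div_div, div_lt_div_iff_of_pos_right hω,
    abs_lt]
  constructor
  · rw [lt_sub_iff_add_lt, lt_div_iff₀ ha0]; nlinarith
  · rw [sub_lt_iff_lt_add, div_lt_iff₀ ha0]; nlinarith

/-- The window `(π/2, 3π/2)` contains exactly one branch of `tan`, which `arctan` shifted by `π`
inverts. -/
theorem mem_guard_iff (ε : ℝ) (x : ℝ × ℝ) :
    x ∈ p.guard ε ↔ 0 < x.2 ∧ x.1 = Real.pi + Real.arctan (ε * p.slow x.2) := by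
  have hω := p.ω_pos
  have hγ : p.γ ε x = 0 ↔ Real.tan x.1 = ε * p.slow x.2 := by
    unfold γ slow
    rw [sub_eq_zero, ← mul_div_assoc, eq_div_iff hω.ne', mul_comm]
  have htan : Real.tan (x.1 - Real.pi) = Real.tan x.1 := Real.tan_sub_pi _
  unfold guard
  simp only [mem_ofPred_eq, hγ]
  constructor
  · rintro ⟨h1, h2, h3⟩
    refine ⟨h2, ?_⟩
    rw [← h3, ← htan, Real.arctan_tan (by linarith [h1.1]) (by linarith [h1.2])]
    ring
  · rintro ⟨h1, h2⟩
    refine ⟨liftoff_mem_Ioo h2, h1, ?_⟩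
    rw [← htan, h2, add_sub_cancel_left, Real.tan_arctan]

theorem mem_guard_amp_iff (ε ψ : ℝ) {j : ℝ} (hj : |j| ≤ p.rate / 2) :
    (ψ, p.amp j) ∈ p.guard ε ↔ ψ = Real.pi + Real.arctan (ε * j) := by
  rw [mem_guard_iff]
  simp only [p.amp_pos hj, true_and]
  rw [p.slow_amp]

theorem stanceField_eq (ε : ℝ) (x : ℝ × ℝ) :
    p.stanceField ε x = p.ω • p.system.field ε x := by
  have hω := p.ω_pos
  ext
  · simp [stanceField, system, HybridFamily.field]
    field_simp
  · simp [stanceField, system, HybridFamily.field]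
    field_simp

/-- Since `a β - k = -ω a j`, the factor `v` equals `-ω² a j cos ψ`. -/
theorem field_amp (ε ψ : ℝ) {j : ℝ} (hj : |j| ≤ p.rate / 2) :
    p.system.field ε (ψ, p.amp j) =
      (slowDenom ε ψ j, ε * (j * p.amp j * Real.cos ψ ^ 2)) := by
  have hω := p.ω_pos; have hk := p.k_pos
  have hd : p.ω * j + p.β ≠ 0 := by linarith [p.denom_pos hj, p.β_pos]
  ext
  · simp only [HybridFamily.field, system, perturbation, v, amp, slowDenom, Prod.smul_mk,
      Prod.mk_add_mk, smul_eq_mul]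
    field_simp
    ring
  · simp only [HybridFamily.field, system, perturbation, v, amp, Prod.smul_mk,
      Prod.mk_add_mk, smul_eq_mul]
    field_simp
    ring

theorem hasDerivWithinAt_phaseCurve {ε : ℝ} (hε : 0 ≤ ε) (hs : ε * p.rate ≤ 1 / 100)
    {j : ℝ → ℝ} (hj : IsSlowSolution p.rate ε j) {ψ : ℝ} (hψ : ψ ∈ Icc 0 (2 * Real.pi)) :
    HasDerivWithinAt (fun ψ => (ψ, p.amp (j ψ)))
      ((slowDenom ε ψ (j ψ))⁻¹ • p.system.field ε (ψ, p.amp (j ψ)))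
      (Icc 0 (2 * Real.pi)) ψ := by
  have hω := p.ω_pos; have hk := p.k_pos
  have hd : p.ω * j ψ + p.β ≠ 0 := by linarith [p.denom_pos (hj.abs_le ψ), p.β_pos]
  have hD : slowDenom ε ψ (j ψ) ≠ 0 := by linarith [(slowDenom_bounds hε hs ψ (hj.abs_le ψ)).1]
  refine ((hasDerivWithinAt_id ψ _).prodMk
    ((p.hasDerivAt_amp hd).comp_hasDerivWithinAt ψ (hj.deriv ψ hψ))).congr_deriv ?_
  rw [p.field_amp ε ψ (hj.abs_le ψ)]
  ext
  · simp [hD]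
  · simp only [amp, slowRate, rate, Prod.smul_mk, smul_eq_mul]
    field_simp

/-- A slow solution, reparametrized by the dimensionless time, is a trajectory. -/
theorem exists_trajectory {ε : ℝ} (hε : 0 ≤ ε) (hs : ε * p.rate ≤ 1 / 100)
    {j : ℝ → ℝ} (hj : IsSlowSolution p.rate ε j) (ψ₀ : ℝ) :
    ∃ σ : ℝ → ℝ, StrictMono σ ∧ σ 0 = ψ₀ ∧
      (∀ ψ, σ (∫ u in ψ₀..ψ, (slowDenom ε u (j u))⁻¹) = ψ) ∧
      ∀ (s : Set ℝ), MapsTo σ s (Icc 0 (2 * Real.pi)) → ∀ t ∈ s,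
        HasDerivWithinAt (fun t => (σ t, p.amp (j (σ t))))
          (p.system.field ε (σ t, p.amp (j (σ t)))) s t := by
  have hb := fun u => slowDenom_bounds hε hs u (hj.abs_le u)
  have hc : Continuous fun u => (slowDenom ε u (j u))⁻¹ :=
    (continuous_slowDenom_comp continuous_id hj.continuous).inv₀ fun u => by
      simp only [id]; linarith [(hb u).1]
  -- `2/3` is the reciprocal of the upper bound `3/2` for `slowDenom`.
  obtain ⟨σ, hσ, hσd, hσi⟩ := exists_timeChange hc (m := 2 / 3) (by norm_num)
    (fun u => by
      rw [le_inv_comm₀ (by norm_num) (by linarith [(hb u).1])]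
      norm_num; exact (hb u).2) ψ₀
  refine ⟨σ, hσ, by simpa using hσi ψ₀, hσi, fun s hsm t ht => ?_⟩
  have h := (p.hasDerivWithinAt_phaseCurve hε hs hj (hsm ht)).scomp t
    (hσd t).hasDerivWithinAt hsm
  refine h.congr_deriv ?_
  rw [inv_inv, smul_smul, mul_inv_cancel₀ (by linarith [(hb (σ t)).1]), one_smul]

theorem radicand_eq (a θ : ℝ) :
    a ^ 2 * Real.cos (Real.pi + Real.arctan θ) ^ 2 -
        2 * p.g * a * Real.sin (Real.pi + Real.arctan θ) / p.ω ^ 2 =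
      a * (√(1 + θ ^ 2))⁻¹ * (a * (√(1 + θ ^ 2))⁻¹ + 2 * (p.g / p.ω ^ 2) * θ) := by
  have hω := p.ω_pos
  rw [add_comm Real.pi, Real.cos_add_pi, Real.sin_add_pi, Real.cos_arctan, Real.sin_arctan]
  field_simp
  ring

/-- Only `slow a < 0` is critical. Then `a ≥ k/β` and `slow a ≥ -ν`, so the gravity term is at least
`-2 (g/ω²) ε ν ≥ -a/2` by the second bound in `epsMax`, while the cosine factor exceeds `1/2`. The
whole guard is covered, not only a neighbourhood of the base point. -/
theorem radicand_factor_pos {ε a : ℝ} (hε : 0 ≤ ε) (hε' : ε ≤ p.epsMax) (ha : 0 < a) :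
    0 < a * (√(1 + (ε * p.slow a) ^ 2))⁻¹ + 2 * (p.g / p.ω ^ 2) * (ε * p.slow a) := by
  have hω := p.ω_pos; have hg := p.g_pos; have hβ := p.β_pos; have hk := p.k_pos
  rcases le_or_gt 0 (p.slow a) with h | h
  · have : 0 < √(1 + (ε * p.slow a) ^ 2) := by positivity
    positivity
  have h1 : -p.rate ≤ p.slow a := by
    unfold slow rate
    rw [← neg_div, div_le_div_iff_of_pos_right hω]
    have : 0 < p.k / a := by positivity
    linarith
  have h2 : p.k / p.β ≤ a := by
    unfold slow at h
    have : p.k / a - p.β < 0 := by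
      by_contra hcon
      exact absurd h (not_lt.2 (div_nonneg (not_lt.1 hcon) hω.le))
    rw [div_le_iff₀ hβ]
    rw [sub_neg, div_lt_iff₀ ha] at this
    linarith
  have hr := p.mul_rate_le hε'
  have hG := p.mul_gravity_le hε'
  have h3 : -(ε * p.rate) ≤ ε * p.slow a := by nlinarith
  have h4 : ε * p.slow a ≤ 0 := mul_nonpos_of_nonneg_of_nonpos hε h.le
  have h5 : (ε * p.slow a) ^ 2 ≤ 1 := by nlinarith
  have hs0 : 0 < √(1 + (ε * p.slow a) ^ 2) := by positivity
  have h6 : √(1 + (ε * p.slow a) ^ 2) < 2 := by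
    rw [Real.sqrt_lt' (by norm_num)]; linarith
  have h7 : (1 : ℝ) / 2 < (√(1 + (ε * p.slow a) ^ 2))⁻¹ := by
    rw [one_div]; exact inv_strictAnti₀ hs0 h6
  have hb : 0 < p.k / p.β := by positivity
  have hG0 : 0 < p.g / p.ω ^ 2 := by positivity
  have h8 : p.g / p.ω ^ 2 * -(ε * p.rate) ≤ p.g / p.ω ^ 2 * (ε * p.slow a) := by gcongr
  nlinarith

theorem radicand_pos {ε : ℝ} (hε : 0 ≤ ε) (hε' : ε ≤ p.epsMax) {x : ℝ × ℝ}
    (hx : x ∈ p.guard ε) :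
    0 < x.2 ^ 2 * Real.cos x.1 ^ 2 - 2 * p.g * x.2 * Real.sin x.1 / p.ω ^ 2 := by
  obtain ⟨ha, hψ⟩ := (p.mem_guard_iff ε x).1 hx
  rw [hψ, radicand_eq]
  have := p.radicand_factor_pos hε hε' ha
  positivity

end VerticalHopper

/-! ### The reset along the guard and its expansion in ε -/

namespace VerticalHopper

variable (p : VerticalHopper)

/-- The factor `(1 + ε² j²)^(-1/2) = -cos ψ` on the guard. -/
noncomputable def cosFactor (ε j : ℝ) : ℝ := (√(1 + (ε * j) ^ 2))⁻¹

/-- The touchdown amplitude after liftoff with slow variable `j`. -/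
noncomputable def resetAmp (ε j : ℝ) : ℝ :=
  √(p.amp j * cosFactor ε j * (p.amp j * cosFactor ε j + 2 * (p.g / p.ω ^ 2) * (ε * j)))

/-- The derivative of `amp`. -/
noncomputable def ampDeriv (j : ℝ) : ℝ := -(p.k * p.ω) / (p.ω * j + p.β) ^ 2

/-- The derivative of `amp j * cosFactor ε j` in `j`. -/
noncomputable def speedDeriv (ε j : ℝ) : ℝ :=
  p.ampDeriv j * cosFactor ε j + p.amp j * (-(ε ^ 2 * j * cosFactor ε j ^ 3))

/-- The derivative of `resetAmp` in `j`. -/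
noncomputable def resetAmpDeriv (ε j : ℝ) : ℝ :=
  (p.speedDeriv ε j * (p.amp j * cosFactor ε j + 2 * (p.g / p.ω ^ 2) * (ε * j)) +
    p.amp j * cosFactor ε j * (p.speedDeriv ε j + 2 * (p.g / p.ω ^ 2) * ε)) /
    (2 * p.resetAmp ε j)

theorem cosFactor_pos (ε j : ℝ) : 0 < cosFactor ε j := by
  unfold cosFactor; positivity

theorem cosFactor_sq (ε j : ℝ) : cosFactor ε j ^ 2 * (1 + (ε * j) ^ 2) = 1 := by
  unfold cosFactor
  rw [inv_pow, Real.sq_sqrt (by positivity)]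
  exact inv_mul_cancel₀ (by positivity)

theorem hasDerivAt_cosFactor (ε j : ℝ) :
    HasDerivAt (cosFactor ε) (-(ε ^ 2 * j * cosFactor ε j ^ 3)) j := by
  have h1 : HasDerivAt (fun j => 1 + (ε * j) ^ 2) (2 * (ε * j) * ε) j := by
    have := (((hasDerivAt_id j).const_mul ε).pow 2).const_add 1
    simpa using this
  have h2 := (h1.sqrt (by positivity)).inv (by positivity)
  refine h2.congr_deriv ?_
  unfold cosFactor
  have : 0 < √(1 + (ε * j) ^ 2) := by positivity
  field_simp

theorem reset_liftoff (ε j : ℝ) :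
    p.reset (Real.pi + Real.arctan (ε * j), p.amp j) = (0, p.resetAmp ε j) := by
  unfold reset resetAmp cosFactor
  simp only
  rw [radicand_eq]

theorem resetAmp_factor_pos {ε j : ℝ} (hε : 0 ≤ ε) (hε' : ε ≤ p.epsMax)
    (hj : |j| ≤ p.rate / 2) :
    0 < p.amp j * cosFactor ε j + 2 * (p.g / p.ω ^ 2) * (ε * j) := by
  have := p.radicand_factor_pos hε hε' (p.amp_pos hj)
  rwa [p.slow_amp] at this

theorem resetAmp_pos {ε j : ℝ} (hε : 0 ≤ ε) (hε' : ε ≤ p.epsMax) (hj : |j| ≤ p.rate / 2) :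
    0 < p.resetAmp ε j :=
  Real.sqrt_pos.2 (mul_pos (mul_pos (p.amp_pos hj) (cosFactor_pos ε j))
    (p.resetAmp_factor_pos hε hε' hj))

theorem hasDerivAt_resetAmp {ε j : ℝ} (hε : 0 ≤ ε) (hε' : ε ≤ p.epsMax)
    (hj : |j| ≤ p.rate / 2) : HasDerivAt (p.resetAmp ε) (p.resetAmpDeriv ε j) j := by
  have hd : p.ω * j + p.β ≠ 0 := by linarith [p.denom_pos hj, p.β_pos]
  have hu : HasDerivAt (fun j => p.amp j * cosFactor ε j) (p.speedDeriv ε j) j :=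
    (p.hasDerivAt_amp hd).mul (hasDerivAt_cosFactor ε j)
  have hw : HasDerivAt (fun j => 2 * (p.g / p.ω ^ 2) * (ε * j)) (2 * (p.g / p.ω ^ 2) * ε) j := by
    have := ((hasDerivAt_id j).const_mul ε).const_mul (2 * (p.g / p.ω ^ 2))
    simpa using this
  exact (hu.mul (hu.add hw)).sqrt (mul_pos (mul_pos (p.amp_pos hj) (cosFactor_pos ε j))
    (p.resetAmp_factor_pos hε hε' hj)).ne'

theorem resetAmp_zero (ε : ℝ) : p.resetAmp ε 0 = p.k / p.β := by
  have hb : 0 < p.k / p.β := div_pos p.k_pos p.β_pos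
  simp [resetAmp, cosFactor, amp_zero, Real.sqrt_mul_self hb.le]

theorem resetAmpDeriv_zero (ε : ℝ) :
    p.resetAmpDeriv ε 0 = p.ampDeriv 0 + p.g / p.ω ^ 2 * ε := by
  have hb : p.k / p.β ≠ 0 := (div_pos p.k_pos p.β_pos).ne'
  have hc : cosFactor ε 0 = 1 := by simp [cosFactor]
  simp only [resetAmpDeriv, p.resetAmp_zero, speedDeriv, amp_zero, hc]
  rw [div_eq_iff (mul_ne_zero two_ne_zero hb)]
  ring

/-- First order expansion in `ε`, uniform in `j`, of the derivative of the reset amplitude. -/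
theorem exists_resetAmpDeriv_bound : ∃ C, 0 ≤ C ∧ ∀ ε ∈ Icc 0 p.epsMax, ∀ j, |j| ≤ p.rate / 2 →
    |p.resetAmpDeriv ε j - (p.ampDeriv j + p.g / p.ω ^ 2 * ε)| ≤ C * ε ^ 2 := by
  set G := p.g / p.ω ^ 2 with hG
  set K : Set (ℝ × ℝ) := Icc 0 p.epsMax ×ˢ Icc (-(p.rate / 2)) (p.rate / 2) with hK
  have hKj : ∀ q ∈ K, |q.2| ≤ p.rate / 2 := fun q hq => abs_le.2 hq.2
  -- `B` is the square root completed to a square: the radicand is `B² - (G ε j)²`, so `resetAmp`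
  -- equals `B` up to `O(ε²)`.
  set B : ℝ × ℝ → ℝ := fun q => p.amp q.2 * cosFactor q.1 q.2 + G * (q.1 * q.2) with hB
  -- The exact remainder divided by `ε²`: the first term comes from replacing the root by `B`, the
  -- second from `cosFactor - 1`, the third from the derivative of `cosFactor`. It is continuous on
  -- the compact set `K`, hence bounded.
  set Rm : ℝ × ℝ → ℝ := fun q =>
    ((p.speedDeriv q.1 q.2 + G * q.1) * (G ^ 2 * q.2 ^ 2 / (B q + p.resetAmp q.1 q.2)) -
      G ^ 2 * q.2) / p.resetAmp q.1 q.2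
    - p.ampDeriv q.2 * (q.2 ^ 2 * cosFactor q.1 q.2 ^ 2 / (1 + cosFactor q.1 q.2))
    - p.amp q.2 * (q.2 * cosFactor q.1 q.2 ^ 3) with hRm
  have hρ : ∀ q ∈ K, 0 < p.resetAmp q.1 q.2 := fun q hq =>
    p.resetAmp_pos hq.1.1 hq.1.2 (hKj q hq)
  have hB0 : ∀ q ∈ K, 0 < B q := fun q hq => by
    have h1 := p.resetAmp_factor_pos hq.1.1 hq.1.2 (hKj q hq)
    have h2 := mul_pos (p.amp_pos (hKj q hq)) (cosFactor_pos q.1 q.2)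
    simp only [hB]; linarith
  have hcf : Continuous fun q : ℝ × ℝ => cosFactor q.1 q.2 := by
    unfold cosFactor
    refine Continuous.inv₀ (by fun_prop) fun q => ?_
    positivity
  have hdn : ∀ q ∈ K, p.ω * q.2 + p.β ≠ 0 := fun q hq => by
    linarith [p.denom_pos (hKj q hq), p.β_pos]
  have hcfo := hcf.continuousOn (s := K)
  have hamp : ContinuousOn (fun q : ℝ × ℝ => p.amp q.2) K :=
    ContinuousOn.div (by fun_prop) (by fun_prop) hdn
  have hampd : ContinuousOn (fun q : ℝ × ℝ => p.ampDeriv q.2) K :=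
    ContinuousOn.div (by fun_prop) (by fun_prop) fun q hq => pow_ne_zero 2 (hdn q hq)
  have hBc : ContinuousOn B K := by simp only [hB]; fun_prop
  have hρc : ContinuousOn (fun q : ℝ × ℝ => p.resetAmp q.1 q.2) K := by
    unfold resetAmp; fun_prop
  have hsc : ContinuousOn (fun q : ℝ × ℝ => p.speedDeriv q.1 q.2) K := by
    unfold speedDeriv; fun_prop
  have hRc : ContinuousOn Rm K := by
    refine ContinuousOn.sub (ContinuousOn.sub (ContinuousOn.div (ContinuousOn.sub
      (ContinuousOn.mul (by fun_prop) (ContinuousOn.div (by fun_prop) (hBc.add hρc) ?_))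
      (by fun_prop)) hρc ?_) (ContinuousOn.mul hampd (ContinuousOn.div (by fun_prop)
      (by fun_prop) ?_))) (by fun_prop)
    · exact fun q hq => (add_pos (hB0 q hq) (hρ q hq)).ne'
    · exact fun q hq => (hρ q hq).ne'
    · exact fun q _ => by linarith [cosFactor_pos q.1 q.2]
  obtain ⟨C, hC⟩ := (isCompact_Icc.prod isCompact_Icc).exists_bound_of_continuousOn hRc
  refine ⟨max C 0, le_max_right _ _, fun ε hε j hj => ?_⟩
  have hq : ((ε, j) : ℝ × ℝ) ∈ K := ⟨hε, abs_le.1 hj⟩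
  have hCq := hC _ hq
  suffices h : p.resetAmpDeriv ε j - (p.ampDeriv j + G * ε) = ε ^ 2 * Rm (ε, j) by
    rw [h, abs_mul, abs_of_nonneg (sq_nonneg ε), mul_comm]
    gcongr
    exact hCq.trans (le_max_left _ _)
  have hρq := hρ _ hq
  have hBq := hB0 _ hq
  have hc0 := cosFactor_pos ε j
  have hc2 := cosFactor_sq ε j
  have hsq : p.resetAmp ε j ^ 2 = B (ε, j) ^ 2 - (G * (ε * j)) ^ 2 := by
    unfold resetAmp
    rw [Real.sq_sqrt (mul_pos (mul_pos (p.amp_pos hj) hc0)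
      (p.resetAmp_factor_pos hε.1 hε.2 hj)).le]
    simp only [hB]; ring
  have e1 : B (ε, j) - p.resetAmp ε j =
      ε ^ 2 * (G ^ 2 * j ^ 2 / (B (ε, j) + p.resetAmp ε j)) := by
    have : B (ε, j) + p.resetAmp ε j ≠ 0 := (add_pos hBq hρq).ne'
    field_simp
    linear_combination -hsq
  have e2 : p.resetAmpDeriv ε j * p.resetAmp ε j =
      B (ε, j) * (p.speedDeriv ε j + G * ε) - G ^ 2 * ε ^ 2 * j := by
    unfold resetAmpDeriv
    simp only [hB, ← hG]
    have : p.resetAmp ε j ≠ 0 := hρq.ne'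
    field_simp
    ring
  have e3 : p.resetAmpDeriv ε j - (p.speedDeriv ε j + G * ε) =
      ε ^ 2 * (((p.speedDeriv ε j + G * ε) * (G ^ 2 * j ^ 2 / (B (ε, j) + p.resetAmp ε j)) -
        G ^ 2 * j) / p.resetAmp ε j) := by
    rw [← mul_div_assoc, eq_div_iff hρq.ne']
    linear_combination e2 + (p.speedDeriv ε j + G * ε) * e1
  have e4 : cosFactor ε j - 1 = -ε ^ 2 * (j ^ 2 * cosFactor ε j ^ 2 / (1 + cosFactor ε j)) := by
    have : 1 + cosFactor ε j ≠ 0 := by linarith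
    field_simp
    linear_combination hc2
  have e5 : p.speedDeriv ε j = p.ampDeriv j * cosFactor ε j +
    p.amp j * (-(ε ^ 2 * j * cosFactor ε j ^ 3)) := rfl
  simp only [hRm]
  linear_combination e3 + e5 + p.ampDeriv j * e4

theorem exists_ampDeriv_lipschitz : ∃ C, 0 ≤ C ∧ ∀ i j, |i| ≤ p.rate / 2 → |j| ≤ p.rate / 2 →
    |p.ampDeriv i - p.ampDeriv j| ≤ C * |i - j| := by
  have hc : ContDiffOn ℝ 1 p.ampDeriv (Icc (-(p.rate / 2)) (p.rate / 2)) := by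
    refine ContDiffOn.div (by fun_prop) (by fun_prop) fun j hj => pow_ne_zero 2 ?_
    linarith [p.denom_pos (abs_le.2 hj), p.β_pos]
  obtain ⟨K, hK⟩ := hc.exists_lipschitzOnWith one_ne_zero (convex_Icc _ _) isCompact_Icc
  exact ⟨K, K.2, fun i j hi hj => by
    simpa [Real.dist_eq] using hK.dist_le_mul i (abs_le.1 hi) j (abs_le.1 hj)⟩

/-- The first order coefficient of the derivative of the flow-to-reset map. -/
noncomputable def resetCoeff (y : ℝ) : ℝ := -(p.g * p.k / (p.ω ^ 3 * y ^ 2))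

/-- Expansion of the derivative of the flow-to-reset map, given by the slow flow. -/
theorem exists_resetExpansion_bound : ∃ C, ∀ ε ∈ Ico 0 p.epsMax,
    ∀ (J : ℝ → ℝ → ℝ) (Ψ : ℝ → ℝ), Continuous (Function.uncurry J) →
    (∀ y, IsSlowSolution p.rate ε (J y)) → (∀ y, |y| ≤ p.rate / 4 → J y Real.pi = y) →
    (∀ y, Ψ y = Real.pi + Real.arctan (ε * J y (Ψ y))) →
    ∀ y, |y - p.k / p.β| < p.k / p.β / 5 →
      ∃ d, HasDerivAt (fun y => p.resetAmp ε (J (p.slow y) (Ψ (p.slow y)))) d y ∧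
        |d - (1 + ε * p.resetCoeff y)| ≤ C * ε ^ 2 := by
  obtain ⟨C₁, hC₁, h₁⟩ := p.exists_resetAmpDeriv_bound
  obtain ⟨C₂, hC₂, h₂⟩ := p.exists_ampDeriv_lipschitz
  have hω := p.ω_pos; have hk := p.k_pos; have hβ := p.β_pos; have hg := p.g_pos
  have hν := p.rate_pos
  have hb : 0 < p.k / p.β := div_pos hk hβ
  set ν := p.rate with hνdef
  -- Bound for the derivative of `slow` on `y ≥ (4/5) k/β`.
  set Zb : ℝ := p.k / (p.ω * (4 / 5 * (p.k / p.β)) ^ 2) with hZb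
  have hZb0 : 0 ≤ Zb := by positivity
  have hmax := p.epsMax_pos
  set G := p.g / p.ω ^ 2 with hG
  have hG0 : 0 ≤ G := by positivity
  refine ⟨Zb * (C₁ + C₂ * ν ^ 3) * 2 + (1 + p.epsMax * (G * Zb)) * (21 * ν ^ 2), ?_⟩
  intro ε hε J Ψ hJ hsol hJπ hΨ y hy
  have hs := p.mul_rate_le hε.2.le
  obtain ⟨hy0, hj0⟩ := p.abs_slow_lt hy
  obtain ⟨hx, d₂, hd₂, hd₂'⟩ := hasDerivAt_liftoff hν hε.1 hs hJ hsol hJπ hΨ hj0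
  set j₀ := p.slow y with hj₀
  set x := J j₀ (Ψ j₀) with hxdef
  have hxb : |x| ≤ ν / 2 := (hsol j₀).abs_le _
  set Z : ℝ := -(p.k / (p.ω * y ^ 2)) with hZ
  have hZle : |Z| ≤ Zb := by
    rw [hZ, abs_neg, abs_of_nonneg (by positivity), hZb]
    have : 4 / 5 * (p.k / p.β) ≤ y := by linarith [(abs_lt.1 hy).1]
    gcongr
  -- The chain rule for `amp ∘ slow = id`; this product is the leading coefficient `S₀ = 1`.
  have hAZ : p.ampDeriv j₀ * Z = 1 := by
    have : p.ω * j₀ + p.β = p.k / y := by rw [hj₀]; unfold slow; field_simp; ring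
    unfold ampDeriv
    rw [this, hZ]
    field_simp
  have hGZ : G * Z = p.resetCoeff y := by
    rw [hG, hZ]; unfold resetCoeff; field_simp
  refine ⟨p.resetAmpDeriv ε x * (d₂ * Z), ?_, ?_⟩
  · have hin : HasDerivAt (fun y => J (p.slow y) (Ψ (p.slow y))) (d₂ * Z) y :=
      HasDerivAt.comp (h₂ := fun j => J j (Ψ j)) y hd₂ (p.hasDerivAt_slow hy0.ne')
    exact HasDerivAt.comp (h₂ := p.resetAmp ε) y
      (p.hasDerivAt_resetAmp hε.1 hε.2.le hxb) hin
  have hD : |p.resetAmpDeriv ε x - (p.ampDeriv j₀ + G * ε)| ≤ (C₁ + C₂ * ν ^ 3) * ε ^ 2 := by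
    have a1 := h₁ ε ⟨hε.1, hε.2.le⟩ x hxb
    have a2 := h₂ x j₀ hxb (by linarith)
    have a3 : C₂ * |x - j₀| ≤ C₂ * (ν ^ 3 * ε ^ 2) := by gcongr
    have a4 := abs_add_le (p.resetAmpDeriv ε x - (p.ampDeriv x + G * ε))
      (p.ampDeriv x - p.ampDeriv j₀)
    have a5 : p.resetAmpDeriv ε x - (p.ampDeriv x + G * ε) + (p.ampDeriv x - p.ampDeriv j₀) =
      p.resetAmpDeriv ε x - (p.ampDeriv j₀ + G * ε) := by ring
    rw [a5] at a4
    linarith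
  have hd2 : |d₂| ≤ 2 := by
    have b1 : 21 * ν ^ 2 * ε ^ 2 = 21 * (ε * ν) ^ 2 := by ring
    have hνε : 0 ≤ ε * ν := mul_nonneg hε.1 hν.le
    have b2 : (ε * ν) ^ 2 ≤ (1 / 100) ^ 2 := by gcongr
    have b3 := abs_sub_abs_le_abs_sub d₂ 1
    rw [abs_one] at b3
    linarith
  have hA : |1 + ε * (G * Z)| ≤ 1 + p.epsMax * (G * Zb) := by
    refine (abs_add_le _ _).trans ?_
    rw [abs_one, abs_mul, abs_mul, abs_of_nonneg hε.1, abs_of_nonneg hG0]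
    gcongr
    exact hε.2.le
  have hsplit : p.resetAmpDeriv ε x * (d₂ * Z) - (1 + ε * p.resetCoeff y) =
      Z * (p.resetAmpDeriv ε x - (p.ampDeriv j₀ + G * ε)) * d₂ +
        (1 + ε * (G * Z)) * (d₂ - 1) := by
    rw [← hGZ]
    linear_combination d₂ * hAZ
  rw [hsplit]
  refine (abs_add_le _ _).trans ?_
  rw [abs_mul, abs_mul, abs_mul]
  have c1 : |Z| * |p.resetAmpDeriv ε x - (p.ampDeriv j₀ + G * ε)| * |d₂| ≤
      Zb * ((C₁ + C₂ * ν ^ 3) * ε ^ 2) * 2 := by gcongr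
  have c2 : |1 + ε * (G * Z)| * |d₂ - 1| ≤
      (1 + p.epsMax * (G * Zb)) * (21 * ν ^ 2 * ε ^ 2) := by gcongr
  linarith

end VerticalHopper

/-! ### Averageability -/

namespace VerticalHopper

variable (p : VerticalHopper)

theorem isOpen_X : IsOpen p.system.X := isOpen_Ioo.prod isOpen_Ioi

theorem guard_subset_X (ε : ℝ) : p.guard ε ⊆ p.system.X := fun x hx => by
  have hπ := Real.pi_pos
  exact ⟨⟨by linarith [hx.1.1], hx.1.2⟩, hx.2.1⟩

theorem base_mem_guard (ε : ℝ) : (Real.pi, p.k / p.β) ∈ p.guard ε := by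
  rw [mem_guard_iff]
  simp [slow_base, div_pos p.k_pos p.β_pos]

theorem averagedField_eq (y : ℝ) :
    p.system.averagedField y = -(p.β / (2 * p.ω)) * (y - p.k / p.β) := by
  have hω := p.ω_pos; have hβ := p.β_pos; have hπ := Real.pi_pos
  have h : ∀ σ : ℝ, p.system.F₂ 0 (σ, y) = -(y * p.β - p.k) / p.ω * Real.cos σ ^ 2 := by
    intro σ
    simp only [system, perturbation, v]
    field_simp
  simp only [HybridFamily.averagedField, h, intervalIntegral.integral_const_mul,
    integral_cos_sq]
  simp only [system, smul_eq_mul, Real.sin_pi, Real.sin_zero, Real.cos_pi]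
  field_simp
  ring

theorem fderiv_averagedField (y : ℝ) :
    fderiv ℝ p.system.averagedField y = (-(p.β / (2 * p.ω))) • (1 : ℝ →L[ℝ] ℝ) := by
  have h : HasDerivAt p.system.averagedField (-(p.β / (2 * p.ω))) y := by
    have := ((hasDerivAt_id y).sub_const (p.k / p.β)).const_mul (-(p.β / (2 * p.ω)))
    rw [mul_one] at this
    refine this.congr_of_eventuallyEq (Filter.Eventually.of_forall fun z => ?_)
    exact p.averagedField_eq z
  rw [h.hasFDerivAt.fderiv]
  ext
  simp

theorem differentiableAt_guardPhase (ε : ℝ) {a : ℝ} (ha : 0 < a) :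
    DifferentiableAt ℝ (fun a => Real.pi + Real.arctan (ε * p.slow a)) a :=
  ((p.hasDerivAt_slow ha.ne').differentiableAt.const_mul ε).arctan.const_add _

/-- `γ` itself would not serve: on `X` the tangent has poles, and it has further branches of zeros
near the phases `0` and `-π`. -/
theorem isGuardFunction (ε : ℝ) :
    p.system.IsGuardFunction ε fun x => x.1 - (Real.pi + Real.arctan (ε * p.slow x.2)) := by
  have hω := p.ω_pos
  have hc : ContDiffOn ℝ 1 (fun x : ℝ × ℝ => x.1 - (Real.pi + Real.arctan (ε * p.slow x.2)))
      p.system.X := by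
    have hs : ContDiffOn ℝ 1 (fun x : ℝ × ℝ => p.slow x.2) p.system.X := by
      unfold slow
      refine ContDiffOn.div_const (ContDiffOn.sub (ContDiffOn.div (by fun_prop) (by fun_prop)
        fun x hx => ?_) (by fun_prop)) _
      exact ne_of_gt hx.2
    exact contDiffOn_fst.sub (contDiffOn_const.add (contDiffOn_const.mul hs).arctan)
  refine ⟨hc, ?_, ?_⟩
  · ext x
    change x ∈ p.guard ε ↔ _
    constructor
    · intro hx
      exact ⟨p.guard_subset_X ε hx, sub_eq_zero.2 ((p.mem_guard_iff ε x).1 hx).2⟩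
    · intro hx
      exact (p.mem_guard_iff ε x).2 ⟨hx.1.2, sub_eq_zero.1 hx.2⟩
  · intro x hx h0
    have hd := ((hc.differentiableOn one_ne_zero).differentiableAt
      (p.isOpen_X.mem_nhds (p.guard_subset_X ε hx))).hasFDerivAt
    rw [h0] at hd
    have h1 : HasDerivAt (fun t : ℝ => (t, x.2)) ((1 : ℝ), (0 : ℝ)) x.1 :=
      (hasDerivAt_id x.1).prodMk (hasDerivAt_const _ _)
    have h2 := HasFDerivAt.comp_hasDerivAt (f := fun t : ℝ => (t, x.2)) x.1 hd h1
    have h3 : HasDerivAt (fun t : ℝ => t - (Real.pi + Real.arctan (ε * p.slow x.2))) 1 x.1 :=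
      (hasDerivAt_id x.1).sub_const _
    have := h2.unique h3
    simp at this

/-- The guard is a graph over `a`, and `γ` vanishes along it. If the phase derivative of `γ`
vanished too, so would the amplitude derivative, against regularity. -/
theorem guard_transverse (ε : ℝ) {γ : ℝ × ℝ → ℝ} (hγ : p.system.IsGuardFunction ε γ)
    {x : ℝ × ℝ} (hx : x ∈ p.guard ε) : fderiv ℝ γ x ((1 : ℝ), (0 : ℝ)) ≠ 0 := by
  intro h0
  obtain ⟨hc, hz, hr⟩ := hγ
  have hd := ((hc.differentiableOn one_ne_zero).differentiableAt
    (p.isOpen_X.mem_nhds (p.guard_subset_X ε hx))).hasFDerivAt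
  obtain ⟨ha, hψ⟩ := (p.mem_guard_iff ε x).1 hx
  set φ : ℝ → ℝ × ℝ := fun a => (Real.pi + Real.arctan (ε * p.slow a), a) with hφ
  have hφx : φ x.2 = x := Prod.ext hψ.symm rfl
  have hφd := (p.differentiableAt_guardPhase ε ha).hasDerivAt.prodMk (hasDerivAt_id x.2)
  have h1 := HasFDerivAt.comp_hasDerivAt (f := φ) x.2 (hφx.symm ▸ hd) hφd
  have h2 : HasDerivAt (γ ∘ φ) 0 x.2 := by
    refine (hasDerivAt_const x.2 (0 : ℝ)).congr_of_eventuallyEq ?_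
    filter_upwards [lt_mem_nhds ha] with a ha'
    have : φ a ∈ p.system.G ε := (p.mem_guard_iff ε (φ a)).2 ⟨ha', rfl⟩
    rw [hz] at this
    exact this.2
  have h3 := h1.unique h2
  rw [hφx] at h3
  apply hr x hx
  have h4 : fderiv ℝ γ x ((0 : ℝ), (1 : ℝ)) = 0 := by
    have hsplit : ∀ t : ℝ, ((t, 1) : ℝ × ℝ) = t • ((1 : ℝ), (0 : ℝ)) + ((0 : ℝ), (1 : ℝ)) :=
      fun t => by ext <;> simp
    rw [hsplit, map_add, map_smul, h0, smul_zero, zero_add] at h3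
    exact h3
  ext
  · simpa using h0
  · simpa using h4

theorem contDiffOn_perturbation :
    ContDiffOn ℝ 2 (fun q : ℝ × (ℝ × ℝ) => p.perturbation q.2) (univ ×ˢ p.system.X) := by
  unfold perturbation v
  refine ContDiffOn.prodMk (ContDiffOn.div (by fun_prop) (by fun_prop) fun q hq => ?_)
    (by fun_prop)
  exact mul_ne_zero p.ω_pos.ne' (ne_of_gt hq.2.2)

theorem isFlowToReset {ε : ℝ} (hε : ε ∈ Ico 0 p.epsMax) {J : ℝ → ℝ → ℝ} {Ψ : ℝ → ℝ}
    (hJ : Continuous (Function.uncurry J)) (hsol : ∀ y, IsSlowSolution p.rate ε (J y))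
    (hJπ : ∀ y, |y| ≤ p.rate / 4 → J y Real.pi = y)
    (hΨ : ∀ y, Ψ y = Real.pi + Real.arctan (ε * J y (Ψ y))) :
    p.system.IsFlowToReset ε (Metric.ball (p.k / p.β) (p.k / p.β / 5))
      fun y => p.resetAmp ε (J (p.slow y) (Ψ (p.slow y))) := by
  have hs := p.mul_rate_le hε.2.le
  have hν := p.rate_pos
  have hπ := Real.pi_pos
  have hΨc := continuous_liftoff hν hε.1 hs hJ hsol hΨ
  have hb := fun y u => slowDenom_bounds hε.1 hs u ((hsol y).abs_le u)
  have hgc : Continuous (Function.uncurry fun y u => (slowDenom ε u (J y u))⁻¹) :=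
    Continuous.inv₀ (continuous_slowDenom_comp continuous_snd hJ) fun q => by
      have := (hb q.1 q.2).1
      intro h0
      change slowDenom ε q.2 (J q.1 q.2) = 0 at h0
      linarith
  have hτc := intervalIntegral.continuous_parametric_intervalIntegral_of_continuous
    (a₀ := Real.pi) (μ := MeasureTheory.volume) hgc hΨc
  refine ⟨fun y => ∫ u in Real.pi..Ψ (p.slow y), (slowDenom ε u (J (p.slow y) u))⁻¹, ?_, ?_, ?_⟩
  · refine hτc.comp_continuousOn (f := p.slow) fun y hy => ?_
    exact (p.hasDerivAt_slow (p.abs_slow_lt hy).1.ne').continuousAt.continuousWithinAt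
  -- At the base point `j` vanishes at phase `π`, so `π` solves the liftoff equation and, by
  -- uniqueness, is the liftoff phase.
  · have hJ0 : J 0 Real.pi = 0 := hJπ 0 (by simpa using by linarith)
    have h0 : Ψ 0 = Real.pi := (hsol 0).liftoff_unique hν hε.1 hs (hΨ 0) (by simp [hJ0])
    change ∫ u in Real.pi..Ψ (p.slow (p.k / p.β)), _ = _
    simp only [slow_base, h0, intervalIntegral.integral_same]
  · intro y hy
    obtain ⟨hy0, hj0⟩ := p.abs_slow_lt hy
    set j := J (p.slow y) with hj
    set ψ := Ψ (p.slow y) with hψ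
    have hlift : ψ = Real.pi + Real.arctan (ε * j ψ) := hΨ (p.slow y)
    have hψm := liftoff_mem_Ioo hlift
    obtain ⟨σ, hσ, hσ0, hσi, hσd⟩ := p.exists_trajectory hε.1 hs (hsol (p.slow y)) Real.pi
    set τ := ∫ u in Real.pi..ψ, (slowDenom ε u (j u))⁻¹ with hτ
    -- Whatever the sign of `τ`, monotonicity keeps the phase between `π` and `ψ`.
    have hm : MapsTo σ (uIcc 0 τ) (Ioo (Real.pi / 2) (3 * Real.pi / 2)) := by
      intro t ht
      have h1 : σ t ∈ uIcc (σ 0) (σ τ) := by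
        rcases le_total 0 τ with h | h
        · rw [uIcc_of_le h] at ht
          exact mem_uIcc.2 (Or.inl ⟨hσ.monotone ht.1, hσ.monotone ht.2⟩)
        · rw [uIcc_of_ge h] at ht
          exact mem_uIcc.2 (Or.inr ⟨hσ.monotone ht.1, hσ.monotone ht.2⟩)
      rw [hσ0, hτ, hσi] at h1
      exact (ordConnected_Ioo (a := Real.pi / 2) (b := 3 * Real.pi / 2)).uIcc_subset
        ⟨by linarith, by linarith⟩ hψm h1
    refine ⟨fun t => (σ t, p.amp (j (σ t))), ?_, fun t ht => ⟨?_, ?_⟩, ?_, ?_⟩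
    · change (σ 0, p.amp (j (σ 0))) = (Real.pi, y)
      rw [hσ0, hj, hJπ _ hj0.le, p.amp_slow hy0]
    · exact ⟨⟨by linarith [(hm ht).1], (hm ht).2⟩, p.amp_pos ((hsol _).abs_le _)⟩
    · exact hσd _ (fun t ht => ⟨by linarith [(hm ht).1], by linarith [(hm ht).2]⟩) t ht
    · change (σ τ, p.amp (j (σ τ))) ∈ p.guard ε
      rw [hτ, hσi, p.mem_guard_amp_iff _ _ ((hsol _).abs_le _)]
      exact hlift
    · change _ = (p.reset (σ τ, p.amp (j (σ τ)))).2
      rw [hτ, hσi]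
      have := p.reset_liftoff ε (j ψ)
      rw [← hlift] at this
      rw [this]

theorem W_eq :
    p.system.W 1 (fun y => p.resetCoeff y • (1 : ℝ →L[ℝ] ℝ)) =
      (-(p.g * p.β ^ 2 / (p.k * p.ω ^ 3)) - p.β * Real.pi / (2 * p.ω)) •
        (1 : ℝ →L[ℝ] ℝ) := by
  have hω := p.ω_pos; have hk := p.k_pos; have hβ := p.β_pos
  have h1 : ContinuousLinearMap.adjoint (1 : ℝ →L[ℝ] ℝ) = 1 :=
    ContinuousLinearMap.adjoint_id
  simp only [HybridFamily.W, h1, one_mul, fderiv_averagedField, smul_smul, ← add_smul]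
  congr 1
  simp only [resetCoeff, system]
  field_simp
  ring

theorem W_neg : -(p.g * p.β ^ 2 / (p.k * p.ω ^ 3)) - p.β * Real.pi / (2 * p.ω) < 0 := by
  have := p.ω_pos; have := p.k_pos; have := p.β_pos; have := p.g_pos; have := Real.pi_pos
  have h1 : 0 < p.g * p.β ^ 2 / (p.k * p.ω ^ 3) := by positivity
  have h2 : 0 < p.β * Real.pi / (2 * p.ω) := by positivity
  linarith

theorem isUnit_smul_one {c : ℝ} (hc : c ≠ 0) : IsUnit (c • (1 : ℝ →L[ℝ] ℝ)) := by
  have := isUnit_one (M := ℝ →L[ℝ] ℝ)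
  exact IsUnit.smul (Units.mk0 c hc) this

theorem hasOrthogonalReset :
    p.system.HasOrthogonalReset 1 fun y => p.resetCoeff y • (1 : ℝ →L[ℝ] ℝ) := by
  have h1 : ContinuousLinearMap.adjoint (1 : ℝ →L[ℝ] ℝ) = 1 :=
    ContinuousLinearMap.adjoint_id
  refine ⟨by rw [h1, one_mul], by rw [h1, one_mul], ?_⟩
  rw [W_eq]
  exact isUnit_smul_one p.W_neg.ne

theorem isAverageable :
    p.system.IsAverageable p.epsMax 1 fun y => p.resetCoeff y • (1 : ℝ →L[ℝ] ℝ) where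
  phase_interval := ⟨-(3 * Real.pi / 2), 3 * Real.pi / 2, by linarith [Real.pi_pos],
    by linarith [Real.pi_pos], rfl⟩
  slow_isOpen := isOpen_Ioi
  slow_ball := ⟨Real.expOrderIso.toHomeomorph.symm.trans Homeomorph.unitBall⟩
  base_mem := p.guard_subset_X 0 (p.base_mem_guard 0)
  base_pos := Real.pi_pos
  contDiffOn_F₁ := ((contDiff_fst.comp_contDiffOn p.contDiffOn_perturbation).div_const _).mono
    (prod_mono (subset_univ _) subset_rfl)
  contDiffOn_F₂ := ((contDiff_snd.comp_contDiffOn p.contDiffOn_perturbation).div_const _).mono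
    (prod_mono (subset_univ _) subset_rfl)
  averaged_equilibrium := by
    rw [averagedField_eq]
    simp [system]
  base_mem_guard := fun ε _ => p.base_mem_guard ε
  guard_exists := fun ε _ => ⟨_, p.isGuardFunction ε⟩
  guard_transverse := fun ε _ _ hγ _ hx => p.guard_transverse ε hγ hx
  reset_contDiff := fun ε hε x hx => by
    refine contDiffWithinAt_const.prodMk (ContDiffWithinAt.sqrt ?_
      (p.radicand_pos hε.1 hε.2.le hx).ne')
    have h : ContDiff ℝ 2 fun q : ℝ × (ℝ × ℝ) => q.2.2 ^ 2 * Real.cos q.2.1 ^ 2 -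
        2 * p.g * q.2.2 * Real.sin q.2.1 / p.ω ^ 2 := by fun_prop
    exact h.contDiffWithinAt
  reset_mapsTo := fun ε hε x hx => by
    have hπ := Real.pi_pos
    exact ⟨⟨by simpa [system, reset] using by linarith, by
      simpa [system, reset] using by linarith⟩,
      Real.sqrt_pos.2 (p.radicand_pos hε.1 hε.2.le hx)⟩
  reset_phase := fun _ _ _ _ => rfl
  reset_base := fun ε _ => by
    have h := p.reset_liftoff ε 0
    rw [mul_zero, Real.arctan_zero, add_zero, amp_zero, resetAmp_zero] at h
    change (p.reset (Real.pi, p.k / p.β)).2 = p.k / p.β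
    rw [h]
  reset_expansion := by
    have hπ := Real.pi_pos
    obtain ⟨C, hC⟩ := p.exists_resetExpansion_bound
    -- The range condition sits inside the existential so that the flow and liftoff phase can be
    -- chosen as total functions of `ε`.
    have hflow : ∀ ε, ∃ (J : ℝ → ℝ → ℝ) (Ψ : ℝ → ℝ), ε ∈ Ico 0 p.epsMax →
        Continuous (Function.uncurry J) ∧ (∀ y, IsSlowSolution p.rate ε (J y)) ∧
        (∀ y, |y| ≤ p.rate / 4 → J y Real.pi = y) ∧
        ∀ y, Ψ y = Real.pi + Real.arctan (ε * J y (Ψ y)) := by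
      intro ε
      by_cases hε : ε ∈ Ico 0 p.epsMax
      · obtain ⟨J, hJ, hsol, hJπ⟩ := exists_slowFlow p.rate_pos hε.1 (p.mul_rate_le hε.2.le)
          (s₀ := Real.pi) ⟨by linarith, by linarith⟩
        choose Ψ hΨ using fun y => (hsol y).exists_liftoff
        exact ⟨J, Ψ, fun _ => ⟨hJ, hsol, hJπ, hΨ⟩⟩
      · exact ⟨0, 0, fun h => absurd h hε⟩
    choose J Ψ hJΨ using hflow
    refine ⟨p.k / p.β / 5, by have := div_pos p.k_pos p.β_pos; positivity, C,
      fun ε y => p.resetAmp ε (J ε (p.slow y) (Ψ ε (p.slow y))), fun ε hε => ?_⟩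
    obtain ⟨hJ, hsol, hJπ, hΨ⟩ := hJΨ ε hε
    refine ⟨p.isFlowToReset hε hJ hsol hJπ hΨ, fun y hy => ?_⟩
    obtain ⟨d, hd, hd'⟩ := hC ε hε (J ε) (Ψ ε) hJ hsol hJπ hΨ y hy
    refine ⟨hd.differentiableAt, ?_⟩
    have h1 : fderiv ℝ (fun y => p.resetAmp ε (J ε (p.slow y) (Ψ ε (p.slow y)))) y -
        (1 + ε • p.resetCoeff y • (1 : ℝ →L[ℝ] ℝ)) =
        (d - (1 + ε * p.resetCoeff y)) • (1 : ℝ →L[ℝ] ℝ) := by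
      rw [hd.hasFDerivAt.fderiv]
      ext
      simp
    rw [h1, norm_smul, norm_one, mul_one]
    exact hd'
  S₀_invertible := isUnit_one
  S₀_unity_semisimple := fun v _ => by simp
  hyperbolic := by
    have h := p.hasOrthogonalReset.2.2
    have h1 : ContinuousLinearMap.adjoint (1 : ℝ →L[ℝ] ℝ) = 1 :=
      ContinuousLinearMap.adjoint_id
    simpa only [HybridFamily.W, h1, one_mul] using h

end VerticalHopper

/-! ### Hops, the return map and its stability -/

namespace VerticalHopper

variable (p : VerticalHopper)

theorem continuousOn_of_trajectory {ε T : ℝ} {c : ℝ → ℝ × ℝ}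
    (hc : ∀ t ∈ Icc 0 T, c t ∈ p.system.X ∧
      HasDerivWithinAt c (p.stanceField ε (c t)) (Icc 0 T) t) : ContinuousOn c (Icc 0 T) :=
  fun t ht => (hc t ht).2.continuousWithinAt

theorem exists_rectangle {ε T : ℝ} (hT : 0 < T) {c : ℝ → ℝ × ℝ}
    (hc : ∀ t ∈ Icc 0 T, c t ∈ p.system.X ∧
      HasDerivWithinAt c (p.stanceField ε (c t)) (Icc 0 T) t) :
    ∃ m M, 0 < m ∧ ∀ t ∈ Icc 0 T, c t ∈ Icc (-(3 * Real.pi / 2)) (3 * Real.pi / 2) ×ˢ Icc m M := by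
  have hcont : ContinuousOn (fun t => (c t).2) (Icc 0 T) :=
    continuous_snd.comp_continuousOn (p.continuousOn_of_trajectory hc)
  have hne : (Icc 0 T).Nonempty := ⟨0, le_rfl, hT.le⟩
  obtain ⟨t₁, ht₁, h₁⟩ := isCompact_Icc.exists_isMinOn hne hcont
  obtain ⟨t₂, ht₂, h₂⟩ := isCompact_Icc.exists_isMaxOn hne hcont
  exact ⟨(c t₁).2, (c t₂).2, (hc t₁ ht₁).1.2, fun t ht =>
    ⟨Ioo_subset_Icc_self (hc t ht).1.1, h₁ ht, h₂ ht⟩⟩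

theorem contDiffOn_stanceField (ε : ℝ) {m M : ℝ} (hm : 0 < m) (I : Set ℝ) :
    ContDiffOn ℝ 1 (p.stanceField ε) (I ×ˢ Icc m M) := by
  unfold stanceField perturbation v
  refine ContDiffOn.add (by fun_prop) (ContDiffOn.const_smul _ (ContDiffOn.prodMk
    (ContDiffOn.div (by fun_prop) (by fun_prop) fun x hx => ?_) (by fun_prop)))
  exact mul_ne_zero p.ω_pos.ne' (hm.trans_le hx.2.1).ne'

/-- Uniqueness of stance trajectories in the state space. -/
theorem trajectory_unique {ε T T' : ℝ} (hT : 0 < T) (hTT' : T ≤ T') {c c' : ℝ → ℝ × ℝ}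
    (h0 : c 0 = c' 0)
    (hc : ∀ t ∈ Icc 0 T, c t ∈ p.system.X ∧
      HasDerivWithinAt c (p.stanceField ε (c t)) (Icc 0 T) t)
    (hc' : ∀ t ∈ Icc 0 T', c' t ∈ p.system.X ∧
      HasDerivWithinAt c' (p.stanceField ε (c' t)) (Icc 0 T') t) : EqOn c c' (Icc 0 T) := by
  have hsub : Icc 0 T ⊆ Icc 0 T' := Icc_subset_Icc_right hTT'
  have hc'' : ∀ t ∈ Icc 0 T, c' t ∈ p.system.X ∧
      HasDerivWithinAt c' (p.stanceField ε (c' t)) (Icc 0 T) t := fun t ht =>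
    ⟨(hc' t (hsub ht)).1, (hc' t (hsub ht)).2.mono hsub⟩
  obtain ⟨m, M, hm, h1⟩ := p.exists_rectangle hT hc
  obtain ⟨m', M', hm', h2⟩ := p.exists_rectangle hT hc''
  set K : Set (ℝ × ℝ) := Icc (-(3 * Real.pi / 2)) (3 * Real.pi / 2) ×ˢ
    Icc (min m m') (max M M') with hK
  -- By compactness both trajectories stay in one rectangle with amplitudes bounded away from `0`.
  -- It is compact and convex, so the `C¹` field is Lipschitz on it.
  obtain ⟨L, hL⟩ := (p.contDiffOn_stanceField ε (lt_min hm hm') (M := max M M')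
    (Icc (-(3 * Real.pi / 2)) (3 * Real.pi / 2))).exists_lipschitzOnWith one_ne_zero
    ((convex_Icc _ _).prod (convex_Icc _ _)) (isCompact_Icc.prod isCompact_Icc)
  have hnhds : ∀ t ∈ Ico 0 T, Icc 0 T ∈ nhdsWithin t (Ici t) := fun t ht =>
    Icc_mem_nhdsGE_of_mem ht
  have hd : ∀ c : ℝ → ℝ × ℝ, (∀ t ∈ Icc 0 T, c t ∈ p.system.X ∧
      HasDerivWithinAt c (p.stanceField ε (c t)) (Icc 0 T) t) →
      ∀ t ∈ Ico 0 T, HasDerivWithinAt c (p.stanceField ε (c t)) (Ici t) t := fun c hc t ht =>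
    (hc t (Ico_subset_Icc_self ht)).2.mono_of_mem_nhdsWithin (hnhds t ht)
  refine ODE_solution_unique_of_mem_Icc_right (v := fun _ => p.stanceField ε) (s := fun _ => K)
    (K := L) (fun _ _ => hL) (p.continuousOn_of_trajectory hc) (hd c hc) (fun t ht => ?_)
    (p.continuousOn_of_trajectory hc'') (hd c' hc'') (fun t ht => ?_) h0
  · exact prod_mono subset_rfl (Icc_subset_Icc (min_le_left _ _) (le_max_left _ _))
      (h1 t (Ico_subset_Icc_self ht))
  · exact prod_mono subset_rfl (Icc_subset_Icc (min_le_right _ _) (le_max_right _ _))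
      (h2 t (Ico_subset_Icc_self ht))

/-- Trajectories from the same touchdown agree while both last, so the one stopping earlier would
put the other on the guard before its first hit. -/
theorem isHop_unique {ε a a₁ a₂ : ℝ} {x₁ x₂ : ℝ × ℝ} (h₁ : p.IsHop ε a x₁ a₁)
    (h₂ : p.IsHop ε a x₂ a₂) : a₁ = a₂ := by
  obtain ⟨T, hT, c, hc0, hc, hcg, hcT, hx, hr⟩ := h₁
  obtain ⟨T', hT', c', hc0', hc', hcg', hcT', hx', hr'⟩ := h₂
  have hTT : T = T' := by
    rcases lt_trichotomy T T' with h | h | h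
    · have := p.trajectory_unique hT h.le (hc0.trans hc0'.symm) hc hc' ⟨hT.le, le_rfl⟩
      exact absurd (this ▸ hcT ▸ hx) (hcg' T ⟨hT.le, h⟩)
    · exact h
    · have := p.trajectory_unique hT' h.le (hc0'.trans hc0.symm) hc' hc ⟨hT'.le, le_rfl⟩
      exact absurd (this ▸ hcT' ▸ hx') (hcg T' ⟨hT'.le, h⟩)
  subst hTT
  have h := p.trajectory_unique hT le_rfl (hc0.trans hc0'.symm) hc hc' ⟨hT.le, le_rfl⟩
  have hxx : x₁ = x₂ := by rw [← hcT, ← hcT', h]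
  rw [hxx, hr'] at hr
  exact (congrArg Prod.snd hr).symm

/-- Each touchdown amplitude near `k / β` has a hop, along which the slow variable decays. -/
theorem exists_isHop {ε a : ℝ} (hε : ε ∈ Ico 0 p.epsMax)
    (ha : |a - p.k / p.β| < p.k / p.β / 5) :
    ∃ θ ∈ Icc (0 : ℝ) 1, |θ * p.slow a| ≤ p.rate / 2 ∧
      p.IsHop ε a (Real.pi + Real.arctan (ε * (θ * p.slow a)), p.amp (θ * p.slow a))
        (p.resetAmp ε (θ * p.slow a)) := by
  have hs := p.mul_rate_le hε.2.le
  have hν := p.rate_pos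
  have hπ := Real.pi_pos
  have hω := p.ω_pos
  obtain ⟨ha0, hj0⟩ := p.abs_slow_lt ha
  have h0m : (0 : ℝ) ∈ Icc 0 (2 * Real.pi) := ⟨le_rfl, by linarith⟩
  obtain ⟨J, -, hsol, hJ0⟩ := exists_slowFlow hν hε.1 hs h0m
  set j := J (p.slow a) with hj
  have hjs : IsSlowSolution p.rate ε j := hsol _
  have hj00 : j 0 = p.slow a := hJ0 _ hj0.le
  obtain ⟨ψ, hψ⟩ := hjs.exists_liftoff
  have hψm := liftoff_mem_Ioo hψ
  have hψ0 : 0 < ψ := by linarith [hψm.1]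
  have hdecay : j ψ = Real.exp (-(ε * ∫ u in (0 : ℝ)..ψ, slowQuot p.rate ε u (j u) 0)) *
      p.slow a := by
    have := hjs.sub_eq (isSlowSolution_zero hν) hε.1 hs h0m (liftoff_mem_Icc hψ)
    simp only [sub_zero, hj00] at this
    rw [this, mul_comm]
  -- Against the zero solution the quotient is `cos² ψ (j + ν) / slowDenom`, nonnegative because `j
  -- ≥ -ν/2`.
  have hint : 0 ≤ ∫ u in (0 : ℝ)..ψ, slowQuot p.rate ε u (j u) 0 := by
    refine intervalIntegral.integral_nonneg hψ0.le fun u _ => ?_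
    have h1 := (slowDenom_bounds hε.1 hs u (hjs.abs_le u)).1
    have h2 := (abs_le.1 (hjs.abs_le u)).1
    have h3 : slowDenom ε u 0 = 1 := by simp [slowDenom]
    unfold slowQuot
    rw [h3, mul_one, mul_zero, sub_zero, add_zero]
    exact div_nonneg (mul_nonneg (sq_nonneg _) (by linarith)) (by linarith)
  obtain ⟨σ, hσ, hσ0, hσi, hσd⟩ := p.exists_trajectory hε.1 hs hjs 0
  set τ := ∫ u in (0 : ℝ)..ψ, (slowDenom ε u (j u))⁻¹ with hτ
  have hστ : σ τ = ψ := hσi ψ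
  have hτ0 : 0 < τ := by rw [← hσ.lt_iff_lt, hσ0, hστ]; exact hψ0
  have hm : ∀ t ∈ Icc 0 (τ / p.ω), σ (p.ω * t) ∈ Icc 0 ψ := by
    intro t ht
    rw [← hσ0, ← hστ]
    refine ⟨hσ.monotone (mul_nonneg hω.le ht.1), hσ.monotone ?_⟩
    have := ht.2
    rw [le_div_iff₀ hω] at this
    linarith
  refine ⟨Real.exp (-(ε * ∫ u in (0 : ℝ)..ψ, slowQuot p.rate ε u (j u) 0)),
    ⟨(Real.exp_pos _).le, Real.exp_le_one_iff.2 (neg_nonpos.2 (mul_nonneg hε.1 hint))⟩, ?_⟩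
  rw [← hdecay]
  have hωτ : p.ω * (τ / p.ω) = τ := by field_simp
  refine ⟨hjs.abs_le ψ, τ / p.ω, div_pos hτ0 hω,
    fun t => (σ (p.ω * t), p.amp (j (σ (p.ω * t)))), ?_, fun t ht => ⟨?_, ?_⟩,
    fun t ht hg => ?_, ?_, ?_, p.reset_liftoff ε (j ψ)⟩
  · simp only [mul_zero, hσ0, hj00, p.amp_slow ha0]
  · have := hm t ht
    exact ⟨⟨by linarith [this.1], by linarith [this.2, hψm.2]⟩, p.amp_pos (hjs.abs_le _)⟩
  · rw [stanceField_eq]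
    have hmaps : MapsTo (fun t => p.ω * t) (Icc 0 (τ / p.ω)) (σ ⁻¹' Icc 0 (2 * Real.pi)) :=
      fun t ht => ⟨(hm t ht).1, by linarith [(hm t ht).2, hψm.2]⟩
    have h1 := hσd (σ ⁻¹' Icc 0 (2 * Real.pi)) (fun _ h => h) _ (hmaps ht)
    have h2 : HasDerivWithinAt (fun t => p.ω * t) p.ω (Icc 0 (τ / p.ω)) t := by
      simpa using ((hasDerivAt_id t).const_mul p.ω).hasDerivWithinAt
    exact h1.scomp t h2 hmaps
  -- An earlier guard hit would have the same liftoff phase `ψ`, hence the same time.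
  · have h1 := (p.mem_guard_amp_iff ε _ (hjs.abs_le _)).1 hg
    have h2 := hjs.liftoff_unique hν hε.1 hs h1 hψ
    rw [← hστ] at h2
    have h3 := hσ.injective h2
    have := ht.2
    rw [lt_div_iff₀ hω] at this
    linarith
  · simp only [hωτ, hστ, ← hψ]
  · rw [p.mem_guard_amp_iff ε _ (hjs.abs_le _)]

/-- `amp` is a Möbius map, so the deviation from `k/β` is multiplied exactly by `θ (ω j + β) / (ω θ
j + β)`, which lies in `[0, 1]`. -/
theorem abs_amp_mul_slow_sub_le {a θ : ℝ} (ha : |a - p.k / p.β| < p.k / p.β / 5)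
    (hθ : θ ∈ Icc (0 : ℝ) 1) :
    |p.amp (θ * p.slow a) - p.k / p.β| ≤ |a - p.k / p.β| := by
  obtain ⟨ha0, hj0⟩ := p.abs_slow_lt ha
  have hω := p.ω_pos; have hk := p.k_pos; have hβ := p.β_pos; have hν := p.rate_pos
  set j := p.slow a with hj
  have hd1 : 0 < p.ω * j + p.β := by linarith [p.denom_pos (j := j) (by linarith)]
  have hθj : |θ * j| ≤ p.rate / 2 := by
    rw [abs_mul, abs_of_nonneg hθ.1]
    have := mul_le_of_le_one_left (abs_nonneg j) hθ.2
    linarith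
  have hd2 : 0 < p.ω * (θ * j) + p.β := by linarith [p.denom_pos hθj]
  have hφ : p.amp (θ * j) - p.k / p.β =
      θ * (p.ω * j + p.β) / (p.ω * (θ * j) + p.β) * (a - p.k / p.β) := by
    have : a = p.amp j := (p.amp_slow ha0).symm
    rw [this]
    have hd3 : p.ω * θ * j + p.β ≠ 0 := by rw [mul_assoc]; exact hd2.ne'
    unfold amp
    field_simp
    ring
  rw [hφ, abs_mul]
  refine mul_le_of_le_one_left (abs_nonneg _) ?_
  rw [abs_of_nonneg (div_nonneg (mul_nonneg hθ.1 hd1.le) hd2.le), div_le_one hd2]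
  nlinarith [hθ.2]

/-- On the guard, the reset map contracts the amplitude towards `k / β`. -/
theorem exists_reset_contraction {ε : ℝ} (hε : ε ∈ Ioo 0 p.epsMax) :
    ∃ q, 0 ≤ q ∧ q < 1 ∧ ∃ δ > 0, ∀ a, |a - p.k / p.β| < δ →
      |p.resetAmp ε (p.slow a) - p.k / p.β| ≤ q * |a - p.k / p.β| := by
  have hω := p.ω_pos; have hk := p.k_pos; have hβ := p.β_pos; have hg := p.g_pos
  have hε0 := hε.1
  have hb : 0 < p.k / p.β := div_pos hk hβ
  -- `-c` is `ε` times the reset part of `W`. The decay during stance is not needed for strict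
  -- contraction.
  set c := ε * (p.g * p.β ^ 2 / (p.k * p.ω ^ 3)) with hc
  have hc0 : 0 < c := by positivity
  have hc1 : c ≤ 1 / 4 := by
    have h := p.mul_gravity_le hε.2.le
    unfold rate at h
    rw [le_div_iff₀ hβ] at h
    have h2 : c = p.g / p.ω ^ 2 * (ε * (p.β / p.ω)) * p.β / p.k := by
      rw [hc]; field_simp
    rw [h2, div_le_iff₀ hk]
    linarith
  have hd : HasDerivAt (fun a => p.resetAmp ε (p.slow a)) (1 - c) (p.k / p.β) := by
    have h0 : |p.slow (p.k / p.β)| ≤ p.rate / 2 := by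
      rw [slow_base, abs_zero]; linarith [p.rate_pos]
    have h1 := p.hasDerivAt_resetAmp hε.1.le hε.2.le h0
    have h2 := HasDerivAt.comp (h₂ := p.resetAmp ε) _ h1 (p.hasDerivAt_slow hb.ne')
    refine h2.congr_deriv ?_
    rw [slow_base, resetAmpDeriv_zero, hc]
    unfold ampDeriv
    field_simp
    ring
  -- Half of the gain `c` is kept; the other half absorbs the differentiability remainder.
  refine ⟨1 - c / 2, by linarith, by linarith, ?_⟩
  have ho := (hasDerivAt_iff_isLittleO.1 hd).def (c := c / 2) (by linarith)
  obtain ⟨δ, hδ, h⟩ := Metric.eventually_nhds_iff.1 ho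
  refine ⟨δ, hδ, fun a ha => ?_⟩
  have h1 := h (y := a) (by rwa [Real.dist_eq])
  rw [slow_base, resetAmp_zero, Real.norm_eq_abs, Real.norm_eq_abs, smul_eq_mul] at h1
  have h2 := abs_add_le (p.resetAmp ε (p.slow a) - p.k / p.β - (a - p.k / p.β) * (1 - c))
    ((a - p.k / p.β) * (1 - c))
  rw [sub_add_cancel, abs_mul, abs_of_nonneg (by linarith : 0 ≤ 1 - c)] at h2
  linarith

theorem isExpStableFixedPoint_of_contraction {P : ℝ → ℝ} {S : Set ℝ} {b δ q : ℝ} (hδ : 0 < δ)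
    (hq0 : 0 ≤ q) (hq1 : q < 1) (hS : ∀ a, |a - b| < δ → a ∈ S)
    (hP : ∀ a, |a - b| < δ → |P a - b| ≤ q * |a - b|) : IsExpStableFixedPoint P S b := by
  have hb : |b - b| < δ := by simpa using hδ
  refine ⟨hS b hb, ?_, δ, hδ, 1, q, hq0, hq1, fun a ha n => ?_⟩
  · have := hP b hb
    rw [sub_self, abs_zero, mul_zero] at this
    exact sub_eq_zero.1 (abs_eq_zero.1 (le_antisymm this (abs_nonneg _)))
  · suffices h : |P^[n] a - b| ≤ q ^ n * |a - b| by
      refine ⟨hS _ (h.trans_lt ?_), by simpa using h⟩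
      exact (mul_le_of_le_one_left (abs_nonneg _) (pow_le_one₀ hq0 hq1.le)).trans_lt ha
    induction n with
    | zero => simp
    | succ n ih =>
      have hlt : |P^[n] a - b| < δ :=
        ih.trans_lt ((mul_le_of_le_one_left (abs_nonneg _) (pow_le_one₀ hq0 hq1.le)).trans_lt ha)
      rw [Function.iterate_succ_apply', pow_succ']
      calc |P (P^[n] a) - b| ≤ q * |P^[n] a - b| := hP _ hlt
        _ ≤ q * (q ^ n * |a - b|) := by gcongr
        _ = q * q ^ n * |a - b| := by ring

/-- The return map is defined on the fixed ball of radius `k/(5β)`; contraction is claimed only on a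
smaller ball, whose radius may depend on `ε`. -/
theorem exists_stable_returnMap {ε : ℝ} (hε : ε ∈ Ioo 0 p.epsMax) :
    ∃ (P : ℝ → ℝ) (S : Set ℝ), IsOpen S ∧ p.IsReturnMapOn ε P S ∧
      IsExpStableFixedPoint P S (p.k / p.β) := by
  set S : Set ℝ := Metric.ball (p.k / p.β) (p.k / p.β / 5) with hS
  have hε' : ε ∈ Ico 0 p.epsMax := Ioo_subset_Ico_self hε
  have hb : 0 < p.k / p.β := div_pos p.k_pos p.β_pos
  have hhop : ∀ a, a ∈ S → _ := fun a ha => p.exists_isHop hε' (a := a) ha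
  choose! θ hθ hθb hop using hhop
  refine ⟨fun a => p.resetAmp ε (θ a * p.slow a), S, Metric.isOpen_ball,
    fun a ha a' => ⟨fun ⟨x, hx⟩ => p.isHop_unique hx (hop a ha), by rintro rfl; exact ⟨_, hop a ha⟩⟩, ?_⟩
  obtain ⟨q, hq0, hq1, δ, hδ, hq⟩ := p.exists_reset_contraction hε
  refine isExpStableFixedPoint_of_contraction (δ := min δ (p.k / p.β / 5)) (q := q)
    (lt_min hδ (by positivity)) hq0 hq1 (fun a ha => ha.trans_le (min_le_right _ _)) fun a ha => ?_
  have haS : |a - p.k / p.β| < p.k / p.β / 5 := ha.trans_le (min_le_right _ _)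
  have h1 := p.abs_amp_mul_slow_sub_le haS (hθ a haS)
  have h2 := hq _ (h1.trans_lt (ha.trans_le (min_le_left _ _)))
  rw [p.slow_amp] at h2
  exact h2.trans (by gcongr)

theorem isHop_base {ε : ℝ} (hε : ε ∈ Ico 0 p.epsMax) :
    p.IsHop ε (p.k / p.β) (Real.pi, p.k / p.β) (p.k / p.β) := by
  have hb : 0 < p.k / p.β := div_pos p.k_pos p.β_pos
  obtain ⟨θ, -, -, h⟩ := p.exists_isHop hε (a := p.k / p.β) (by simpa using hb)
  simpa [slow_base, amp_zero, resetAmp_zero] using h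

theorem hasDerivAt_height_velocity (ε : ℝ) (c : ℝ → ℝ × ℝ) (t : ℝ) (hpos : 0 < (c t).2)
    (hc : HasDerivAt c (p.stanceField ε (c t)) t) :
    HasDerivAt (fun s => p.height (c s)) (p.velocity (c t)) t ∧
      HasDerivAt (fun s => p.velocity (c s)) (p.stanceAcceleration ε (c t)) t := by
  have hω := p.ω_pos
  have h1 : HasDerivAt (fun s => (c s).1) (p.stanceField ε (c t)).1 t := hc.fst
  have h2 : HasDerivAt (fun s => (c s).2) (p.stanceField ε (c t)).2 t := hc.snd
  have hsc := Real.sin_sq_add_cos_sq (c t).1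
  constructor
  · refine ((h2.mul h1.sin).const_sub p.z₀).congr_deriv ?_
    simp only [stanceField, perturbation, v, velocity, Prod.smul_mk, Prod.mk_add_mk,
      smul_eq_mul]
    field_simp
    ring
  · refine (((h2.mul_const p.ω).mul h1.cos).neg).congr_deriv ?_
    simp only [stanceField, perturbation, v, velocity, stanceAcceleration, control,
      Prod.smul_mk, Prod.mk_add_mk, smul_eq_mul]
    field_simp
    linear_combination (ε * p.ω * ((c t).2 * p.β - p.k) * Real.cos (c t).1) * hsc

theorem reset_energy {ε : ℝ} (hε : ε ∈ Ico 0 p.epsMax) {x : ℝ × ℝ} (hx : x ∈ p.guard ε) :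
    p.height (p.reset x) = p.z₀ ∧ p.velocity (p.reset x) < 0 ∧
      p.flightEnergy (p.reset x) = p.flightEnergy x := by
  have hω := p.ω_pos
  have hQ := p.radicand_pos hε.1 hε.2.le hx
  refine ⟨by simp [height, reset], ?_, ?_⟩
  · simp only [velocity, reset, Real.cos_zero, mul_one]
    exact neg_neg_of_pos (mul_pos (Real.sqrt_pos.2 hQ) hω)
  · simp only [flightEnergy, velocity, height, reset, Real.cos_zero, Real.sin_zero, mul_one,
      mul_zero, sub_zero, neg_sq, mul_pow, Real.sq_sqrt hQ.le]
    field_simp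
    ring

end VerticalHopper

theorem mainTheorem5 (p : VerticalHopper) :
    -- the vector field is the stance equation of motion written in phase-energy coordinates
    (∀ (ε : ℝ) (c : ℝ → ℝ × ℝ) (t : ℝ), 0 < (c t).2 →
      HasDerivAt c (p.stanceField ε (c t)) t →
        HasDerivAt (fun s => p.height (c s)) (p.velocity (c t)) t ∧
        HasDerivAt (fun s => p.velocity (c s)) (p.stanceAcceleration ε (c t)) t) ∧
    ∃ ε₀ > 0,
      -- the reset map takes a liftoff state to the touchdown state of the same energy
      (∀ ε ∈ Set.Ico 0 ε₀, ∀ x ∈ p.guard ε,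
        p.height (p.reset x) = p.z₀ ∧ p.velocity (p.reset x) < 0 ∧
        p.flightEnergy (p.reset x) = p.flightEnergy x) ∧
      -- the hopper is averageable, with orthogonal reset, `S₀ = 1` and `W < 0`
      (∃ S₁ : ℝ → ℝ →L[ℝ] ℝ,
        p.system.IsAverageable ε₀ 1 S₁ ∧
        p.system.HasOrthogonalReset 1 S₁ ∧
        p.system.W 1 S₁ =
          (-(p.g * p.β ^ 2 / (p.k * p.ω ^ 3)) - p.β * Real.pi / (2 * p.ω)) •
            (1 : ℝ →L[ℝ] ℝ) ∧
        -(p.g * p.β ^ 2 / (p.k * p.ω ^ 3)) - p.β * Real.pi / (2 * p.ω) < 0) ∧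
      -- stable hopping, with liftoff state `ε`-close to `(π, k / β)`
      ∃ K : ℝ, ∀ ε ∈ Set.Ioo 0 ε₀, ∃ (b : ℝ) (x : ℝ × ℝ),
        p.IsHop ε b x b ∧
        ‖x - (Real.pi, p.k / p.β)‖ ≤ K * ε ∧ |b - p.k / p.β| ≤ K * ε ∧
        ∃ (P : ℝ → ℝ) (S : Set ℝ), IsOpen S ∧ p.IsReturnMapOn ε P S ∧
          IsExpStableFixedPoint P S b := by
  refine ⟨p.hasDerivAt_height_velocity, p.epsMax, p.epsMax_pos,
    fun ε hε x hx => p.reset_energy hε hx,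
    ⟨fun y => p.resetCoeff y • (1 : ℝ →L[ℝ] ℝ), p.isAverageable, p.hasOrthogonalReset,
      -- `K = 0` suffices, because the periodic hop lifts off exactly at the base point.
      p.W_eq, p.W_neg⟩, 0, fun ε hε => ⟨p.k / p.β, (Real.pi, p.k / p.β),
      p.isHop_base (Ioo_subset_Ico_self hε), by simp, by simp, p.exists_stable_returnMap hε⟩⟩
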